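/- **Corollary (ARFIMA entropy rate as $H\to1$ and $H\to0$).** For $d\in(-\tfrac12,\tfrac12)$, an ARFIMA$(0,d,0)$ process is a stationary, square-integrable process $(X_n)_{n\in\mathbb Z}$ satisfying $$(1-L)^dX_n=\sum_{k\ge0}(-1)^k\binom dk X_{n-k}=\varepsilon_n\qquad(n\in\mathbb Z),$$ with the series converging in mean square, where the $\varepsilon_n$ are i.i.d. centred Gaussian variables with some finite variance $\sigma_\varepsilon^2$, and where $X_n$ is causal, i.e. lies in the mean-square closed linear span of $\{\varepsilon_j: j\le n\}$. Its Hurst parameter is $H=d+\tfrac12\in(0,1)$. The differential entropy rate of a process is $\lim_{n\to\infty}\frac1n h(X_1,\dots,X_n)$, where $h(X_1,\dots,X_n)=-\int f\log f$ for the joint density $f$ of $(X_1,\dots,X_n)$ (natural logarithm). Fix $0<\sigma^2<\infty$. For every $H\in(0,1)$ there is an ARFIMA$(0,H-\tfrac12,0)$ process with variance $\operatorname{Var}(X_0)=\sigma^2$; its differential entropy rate exists (the joint densities exist and the joint entropies are finite) and has a value $h(H)\in\mathbb R$ that depends only on $H$ and $\sigma^2$. Moreover: 1. $h(H)\to-\infty$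 as $H\to1^-$. 2. $h(H)$ stays bounded as $H\to0^+$; more precisely $h(H)\to\frac12\log(2\pi e\,\sigma^2)+\log\Gamma(\tfrac32)$. 3. In contrast, the approximate entropy rate of fractional Gaussian noise, $$\tilde h(H)=\tfrac12\log(2\pi e)+\frac1{4\pi}\int_{-\pi}^{\pi}\log\bigl(2\pi c_f|\lambda|^{1-2H}\bigr)\,d\lambda,\qquad c_f=\frac{\sigma^2}{2\pi}\sin(\pi H)\,\Gamma(2H+1),$$ obtained by putting the low-frequency approximation $c_f|\lambda|^{1-2H}$ of its spectral density into Kolmogorov's formula, tends to $-\infty$ as $H\to0^+$. -/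

import Mathlib

open MeasureTheory ProbabilityTheory Filter Topology Set
open scoped ENNReal NNReal

universe u

noncomputable section

/-- The coefficient of `L ^ k` in the binomial expansion of `(1 - L) ^ d`,
`(-1) ^ k * d (d - 1) ⋯ (d - k + 1) / k!`, which is `Γ(k - d) / (Γ(k + 1) Γ(-d))` when the latter
makes sense. -/
def fracDiffCoeff (d : ℝ) (k : ℕ) : ℝ := (-1) ^ k * Ring.choose d k

/-- `X` is a (causal) ARFIMA(0, `d`, 0) process driven by the Gaussian white noise `ε` with
variance `v`. -/
structure IsARFIMA {Ω : Type*} [MeasurableSpace Ω] (P : Measure Ω) (X ε : ℤ → Ω → ℝ)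
    (d : ℝ) (v : ℝ≥0) : Prop where
  neg_half_lt : -(1 / 2) < d
  lt_half : d < 1 / 2
  /-- The innovations are independent ... -/
  indep : iIndepFun ε P
  /-- ... and normally distributed with mean zero and variance `v`. -/
  law : ∀ n, HasLaw (ε n) (gaussianReal 0 v) P
  /-- `X` has finite second moments. -/
  memLp : ∀ n, MemLp (X n) 2 P
  /-- `X` is (strictly) stationary: shifting time does not change the law of the process. -/
  stationary : ∀ k : ℤ, IdentDistrib (fun ω n => X (n + k) ω) (fun ω n => X n ω) P P
  /-- `(1 - L) ^ d X = ε`, the series converging in mean square. -/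
  equation : ∀ n : ℤ, Tendsto (fun N : ℕ => eLpNorm
    (fun ω => ∑ k ∈ Finset.range N, fracDiffCoeff d k * X (n - k) ω - ε n ω) 2 P) atTop (𝓝 0)
  /-- Causality: `X n` is a mean-square limit of finite linear combinations of the innovations
  up to time `n`. -/
  causal : ∀ n : ℤ, ∀ δ : ℝ≥0∞, 0 < δ → ∃ (N : ℕ) (c : ℕ → ℝ),
    eLpNorm (fun ω => X n ω - ∑ j ∈ Finset.range N, c j * ε (n - j) ω) 2 P < δ

/-- The random vector `Y` has a (joint) density `f` with `f log f` Lebesgue integrable, that is,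
its differential entropy exists and is finite. -/
def HasFiniteEntropy {Ω ι : Type*} [MeasurableSpace Ω] [Fintype ι] (P : Measure Ω)
    (Y : Ω → ι → ℝ) : Prop :=
  HasPDF Y P volume ∧
    Integrable (fun x => (pdf Y P volume x).toReal * Real.log (pdf Y P volume x).toReal)

/-- The joint differential entropy `-∫ f log f` (in nats) of a random vector with density `f`. -/
def differentialEntropy {Ω ι : Type*} [MeasurableSpace Ω] [Fintype ι] (P : Measure Ω)
    (Y : Ω → ι → ℝ) : ℝ :=
  -∫ x, (pdf Y P volume x).toReal * Real.log (pdf Y P volume x).toReal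

/-- The initial segment `(X 1, ..., X n)` of a process. -/
def initialSegment {Ω : Type*} (X : ℤ → Ω → ℝ) (n : ℕ) : Ω → Fin n → ℝ :=
  fun ω i => X ((i : ℤ) + 1) ω

/-- The differential entropy rate `lim h(X 1, ..., X n) / n` of `X` exists and is equal to `r`. -/
def HasEntropyRate {Ω : Type*} [MeasurableSpace Ω] (P : Measure Ω) (X : ℤ → Ω → ℝ)
    (r : ℝ) : Prop :=
  (∀ n : ℕ, HasFiniteEntropy P (initialSegment X n)) ∧
    Tendsto (fun n : ℕ => differentialEntropy P (initialSegment X n) / n) atTop (𝓝 r)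

/-- The low-frequency approximation `c_f |t| ^ (1 - 2 H)` to the spectral density of fractional
Gaussian noise with variance `σ2` and Hurst parameter `H`, where
`c_f = σ2 / (2 π) * sin (π H) * Γ(2 H + 1)`. -/
def fgnApproxSpectralDensity (σ2 H t : ℝ) : ℝ :=
  σ2 / (2 * Real.pi) * Real.sin (Real.pi * H) * Real.Gamma (2 * H + 1) * |t| ^ (1 - 2 * H)

/-- The approximate entropy rate of fractional Gaussian noise: Kolmogorov's expression
`log (2 π e) / 2 + (4 π)⁻¹ ∫_{-π}^{π} log (2 π f(t)) dt` evaluated at the approximate spectral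
density `f`. -/
def fgnApproxEntropyRate (σ2 H : ℝ) : ℝ :=
  1 / 2 * Real.log (2 * Real.pi * Real.exp 1) + 1 / (4 * Real.pi) *
    ∫ t in (-Real.pi)..Real.pi, Real.log (2 * Real.pi * fgnApproxSpectralDensity σ2 H t)

end

/-! ### The coefficients of fractional differencing -/

/-! The driving noise variance `v` determines the entropy rate, and the variance of the process
determines `v`; both limits are then limits of an explicit Gamma quotient.

In `L²` the innovations are orthogonal with squared norm `v`. Causality forces `X n` to be the
moving average of the innovations with the coefficients of `(1 - L) ^ (-d)`
(`isMovingAverage_of_tendsto`). Hence `Var X = v * ∑ c_k²`, and Gauss's summation theorem gives the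
sum as `Γ(1 - 2d) / Γ(1 - d)²` (`tsum_fracDiffCoeff_sq`).

Gram–Schmidt writes `(X 1, ..., X n)` as a unit lower triangular matrix applied to orthogonal, hence
independent, Gaussian prediction errors. The matrix has determinant 1, so the entropy is the sum of
`1/2 log(2πe s)` over the error variances `s` (`IsARFIMA.entropy`). These variances tend to `v`:
none is below `v`, because the newest innovation cannot be predicted, and the truncated equation `(1
- L)^d X = ε` is a predictor whose error tends to `v`. Cesàro averaging yields the rate `1/2 log(2πe
v)`.

With `d = H - 1/2` this gives `v = σ² Γ(3/2 - H)² / Γ(2 - 2H)`. The pole of `Γ` at 0 sends `v` to 0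
as `H → 1`, while `Γ(2) = 1` keeps `v` positive as `H → 0`. For the approximate rate of fractional
Gaussian noise the integral is elementary, and the factor `sin(πH)` sends its logarithm to `-∞`. -/

lemma fracDiffCoeff_zero (d : ℝ) : fracDiffCoeff d 0 = 1 := by
  simp [fracDiffCoeff]

lemma fracDiffCoeff_succ (d : ℝ) (k : ℕ) :
    (k + 1) * fracDiffCoeff d (k + 1) = (k - d) * fracDiffCoeff d k := by
  have h := Ring.choose_smul_choose d (Nat.le_succ k)
  rw [Nat.succ_eq_add_one, Nat.choose_succ_self_right, Nat.add_sub_cancel_left,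
    Ring.choose_one_right, nsmul_eq_mul] at h
  push_cast at h
  rw [fracDiffCoeff, fracDiffCoeff, pow_succ]
  linear_combination (-(-1 : ℝ) ^ k) * h

/-- This is `(1 - x)^d (1 - x)^(-d) = 1` read coefficientwise, an instance of the Chu–Vandermonde
identity. -/
lemma sum_fracDiffCoeff_mul_fracDiffCoeff_neg (d : ℝ) (n : ℕ) :
    ∑ p ∈ Finset.HasAntidiagonal.antidiagonal n, fracDiffCoeff d p.1 * fracDiffCoeff (-d) p.2
      = if n = 0 then 1 else 0 := by
  have h := Ring.add_choose_eq n (Commute.all d (-d))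
  rw [add_neg_cancel, Ring.choose_zero_ite] at h
  have h2 : ∑ p ∈ Finset.HasAntidiagonal.antidiagonal n, fracDiffCoeff d p.1 * fracDiffCoeff (-d) p.2
      = (-1) ^ n * ∑ p ∈ Finset.HasAntidiagonal.antidiagonal n, Ring.choose d p.1 * Ring.choose (-d) p.2 := by
    rw [Finset.mul_sum]
    refine Finset.sum_congr rfl fun p hp => ?_
    rw [← Finset.HasAntidiagonal.mem_antidiagonal.1 hp, fracDiffCoeff, fracDiffCoeff, pow_add]
    ring
  rw [h2, ← h]
  split_ifs with h0 <;> simp [h0]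

lemma sum_range_fracDiffCoeff_mul (d : ℝ) (n : ℕ) :
    ∑ k ∈ Finset.range (n + 1), fracDiffCoeff d k * fracDiffCoeff (-d) (n - k)
      = if n = 0 then 1 else 0 := by
  rw [← sum_fracDiffCoeff_mul_fracDiffCoeff_neg d n,
    Finset.Nat.sum_antidiagonal_eq_sum_range_succ
      (fun i j => fracDiffCoeff d i * fracDiffCoeff (-d) j)]

/-- A Raabe-type test. -/
lemma summable_and_tendsto_of_le_sub {t u : ℕ → ℝ} {c : ℝ} (hc : 0 < c) (ht : ∀ k, 0 ≤ t k)
    (hu : ∀ k, 0 ≤ u k) (h : ∀ᶠ k in atTop, c * t k ≤ u k - u (k + 1)) :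
    Summable t ∧ ∃ l, Tendsto u atTop (𝓝 l) := by
  obtain ⟨N, hN⟩ := eventually_atTop.1 h
  constructor
  · rw [← summable_nat_add_iff N]
    refine summable_of_sum_range_le (c := u N / c) (fun n => ht _) fun n => ?_
    rw [le_div_iff₀ hc, mul_comm, Finset.mul_sum]
    have : ∑ i ∈ Finset.range n, c * t (i + N) ≤ u N - u (n + N) := by
      induction n with
      | zero => simp
      | succ n ih =>
        rw [Finset.sum_range_succ]
        have := hN (n + N) (by omega)
        rw [show n + 1 + N = n + N + 1 by omega]
        linarith
    linarith [hu (n + N)]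
  · have hanti : Antitone fun n => u (n + N) := by
      refine antitone_nat_of_succ_le fun n => ?_
      have := hN (n + N) (by omega)
      have h2 := mul_nonneg hc.le (ht (n + N))
      rw [show n + 1 + N = n + N + 1 by omega]
      linarith
    refine ⟨_, (tendsto_add_atTop_iff_nat N).1 (tendsto_atTop_ciInf hanti ⟨0, ?_⟩)⟩
    rintro _ ⟨n, rfl⟩
    exact hu _

lemma summable_abs_fracDiffCoeff {a : ℝ} (h0 : 0 ≤ a) (h1 : a < 1) :
    Summable fun k => |fracDiffCoeff a k| := by
  rcases h0.eq_or_lt with rfl | h0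
  · refine summable_of_hasFiniteSupport ((Set.finite_singleton 0).subset fun k hk => ?_)
    by_contra hk0
    rw [mem_singleton_iff] at hk0
    apply hk
    simp [fracDiffCoeff, Ring.choose_zero_pos ℝ (Nat.pos_of_ne_zero hk0)]
  -- For `k ≥ 1` the recursion gives the exact identity `k|c_k| - (k+1)|c_{k+1}| = a|c_k|`, so the
  -- Raabe constant is `a` itself.
  · refine (summable_and_tendsto_of_le_sub (u := fun k => k * |fracDiffCoeff a k|) h0
      (fun k => abs_nonneg _) (fun k => by positivity) ?_).1
    filter_upwards [eventually_ge_atTop 1] with k hk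
    have hk' : (1 : ℝ) ≤ k := by exact_mod_cast hk
    have h := congrArg abs (fracDiffCoeff_succ a k)
    rw [abs_mul, abs_mul, abs_of_nonneg (by positivity : (0 : ℝ) ≤ k + 1),
      abs_of_nonneg (by linarith : (0 : ℝ) ≤ k - a)] at h
    push_cast
    rw [h]
    linarith

/-- The last term is `O(1/k)` relative to `c_k²`, so the Raabe-type test applies with any constant
below `1 + 2a`; half of it is used. -/
lemma fracDiffCoeff_sq_sub (a : ℝ) (k : ℕ) :
    (k : ℝ) * fracDiffCoeff a k ^ 2 - ((k : ℝ) + 1) * fracDiffCoeff a (k + 1) ^ 2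
      = (1 + 2 * a) * fracDiffCoeff a k ^ 2
        - (1 + a) ^ 2 / (k + 1) * fracDiffCoeff a k ^ 2 := by
  have h := fracDiffCoeff_succ a k
  have hk : (k : ℝ) + 1 ≠ 0 := by positivity
  have h' : fracDiffCoeff a (k + 1) = (k - a) * fracDiffCoeff a k / (k + 1) := by
    field_simp; linarith
  rw [h']
  field_simp
  ring

lemma fracDiffCoeff_sq_summable_and_tendsto {a : ℝ} (ha : -(1 / 2) < a) :
    (Summable fun k => fracDiffCoeff a k ^ 2) ∧
      Tendsto (fun k : ℕ => (k : ℝ) * fracDiffCoeff a k ^ 2) atTop (𝓝 0) := by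
  obtain ⟨hs, l, hl⟩ := summable_and_tendsto_of_le_sub (c := (1 + 2 * a) / 2)
    (t := fun k => fracDiffCoeff a k ^ 2) (u := fun k => (k : ℝ) * fracDiffCoeff a k ^ 2)
    (by linarith) (fun k => by positivity) (fun k => by positivity) (by
      have h1 : Tendsto (fun k : ℕ => (1 + a) ^ 2 / ((k : ℝ) + 1)) atTop (𝓝 0) :=
        tendsto_const_div_atTop_nhds_zero_nat ((1 + a) ^ 2) |>.comp (tendsto_add_atTop_nat 1)
          |>.congr fun k => by simp
      filter_upwards [h1.eventually (gt_mem_nhds (by linarith : (0 : ℝ) < (1 + 2 * a) / 2))]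
        with k hk
      push_cast
      rw [fracDiffCoeff_sq_sub]
      nlinarith [sq_nonneg (fracDiffCoeff a k)])
  refine ⟨hs, ?_⟩
  have hl0 : 0 ≤ l := ge_of_tendsto' hl fun k => by positivity
  rcases hl0.eq_or_lt with rfl | hpos
  · exact hl
  -- A positive limit `l` would give `c_k² ≥ (l/2)/k` eventually, contradicting summability by
  -- divergence of the harmonic series.
  · exfalso
    have hev := hl.eventually (lt_mem_nhds (half_lt_self hpos))
    have h2 : Summable fun k : ℕ => l / 2 * (1 / (k : ℝ)) := by
      refine (summable_of_isBigO_nat hs (Asymptotics.IsBigO.of_bound 1 ?_))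
      filter_upwards [hev, eventually_gt_atTop 0] with k hk hk0
      have : (0 : ℝ) < k := by exact_mod_cast hk0
      rw [Real.norm_of_nonneg (by positivity), Real.norm_of_nonneg (by positivity), one_mul,
        mul_one_div, div_le_iff₀ this]
      linarith
    exact Real.not_summable_one_div_natCast ((summable_mul_left_iff (by positivity)).1 h2)

lemma summable_fracDiffCoeff_sq {a : ℝ} (ha : -(1 / 2) < a) :
    Summable fun k => fracDiffCoeff a k ^ 2 :=
  (fracDiffCoeff_sq_summable_and_tendsto ha).1

/-! ### The sum of the squares: a case of Gauss's summation theorem -/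

lemma inv_choose_le_one (k m : ℕ) : ((k + m).choose m : ℝ)⁻¹ ≤ 1 := by
  apply inv_le_one_of_one_le₀
  exact_mod_cast Nat.choose_pos (Nat.le_add_left m k)

lemma summable_fracDiffCoeff_sq_div_choose {a : ℝ} (ha : -(1 / 2) < a) (m : ℕ) :
    Summable fun k => fracDiffCoeff a k ^ 2 * ((k + m).choose m : ℝ)⁻¹ := by
  refine Summable.of_nonneg_of_le (fun k => by positivity) (fun k => ?_)
    (summable_fracDiffCoeff_sq ha)
  exact mul_le_of_le_one_right (by positivity) (inv_choose_le_one k m)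

/-- Since `c_k = (-a)_k / k!`, the sum with parameter `m` is the hypergeometric value `₂F₁(-a, -a;
m+1; 1)`, and this is the contiguous relation raising the third parameter. The difference of the two
sides telescopes in `k T k`, whose boundary term vanishes because `k c_k² → 0`. -/
lemma tsum_fracDiffCoeff_sq_div_choose_succ {a : ℝ} (ha : -(1 / 2) < a) (m : ℕ) :
    (m + 1 + 2 * a) * ∑' k, fracDiffCoeff a k ^ 2 * ((k + m).choose m : ℝ)⁻¹
      = (m + 1 + a) ^ 2 / (m + 1) *
        ∑' k, fracDiffCoeff a k ^ 2 * ((k + (m + 1)).choose (m + 1) : ℝ)⁻¹ := by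
  have hs := (summable_fracDiffCoeff_sq_div_choose ha m).hasSum.mul_left (m + 1 + 2 * a)
  have hs' := (summable_fracDiffCoeff_sq_div_choose ha (m + 1)).hasSum.mul_left
    ((m + 1 + a) ^ 2 / (m + 1))
  have hd := (hs.sub hs').tendsto_sum_nat
  set T : ℕ → ℝ := fun k => fracDiffCoeff a k ^ 2 * ((k + m).choose m : ℝ)⁻¹ with hT
  have key : ∀ k : ℕ, (m + 1 + 2 * a) * T k - (m + 1 + a) ^ 2 / (m + 1) *
      (fracDiffCoeff a k ^ 2 * ((k + (m + 1)).choose (m + 1) : ℝ)⁻¹)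
        = k * T k - (k + 1 : ℕ) * T (k + 1) := by
    intro k
    have h := fracDiffCoeff_succ a k
    have hk : (k : ℝ) + 1 ≠ 0 := by positivity
    have h' : fracDiffCoeff a (k + 1) = (k - a) * fracDiffCoeff a k / (k + 1) := by
      field_simp; linarith
    have hc0 : ((k + m).choose m : ℝ) ≠ 0 := by
      exact_mod_cast (Nat.choose_pos (Nat.le_add_left m k)).ne'
    have hc1 : ((k + (m + 1)).choose (m + 1) : ℝ)
        = (k + m + 1) * (k + m).choose m / (m + 1) := by
      have := Nat.add_one_mul_choose_eq (k + m) m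
      have h2 : ((k : ℝ) + m + 1) * (k + m).choose m
          = (k + (m + 1)).choose (m + 1) * (m + 1) := by exact_mod_cast this
      rw [h2]; field_simp
    have hc2 : ((k + 1 + m).choose m : ℝ) = (k + m + 1) * (k + m).choose m / (k + 1) := by
      have := Nat.add_one_mul_choose_eq (k + m) k
      rw [Nat.choose_symm_add, show k + m + 1 = k + 1 + m by ring, Nat.choose_symm_add] at this
      have h2 : ((k : ℝ) + 1 + m) * (k + m).choose m
          = (k + 1 + m).choose m * (k + 1) := by exact_mod_cast this
      rw [show (k : ℝ) + m + 1 = k + 1 + m by ring, h2]; field_simp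
    have hkm : (k : ℝ) + m + 1 ≠ 0 := by positivity
    simp only [hT]
    rw [hc1, hc2, h']
    push_cast
    field_simp
    ring
  have hz : Tendsto (fun k : ℕ => (k : ℝ) * T k) atTop (𝓝 0) := by
    refine squeeze_zero (fun k => by positivity) (fun k => ?_)
      (fracDiffCoeff_sq_summable_and_tendsto ha).2
    exact mul_le_mul_of_nonneg_left
      (mul_le_of_le_one_right (by positivity) (inv_choose_le_one k m)) (by positivity)
  have h0 : Tendsto (fun n => ∑ k ∈ Finset.range n, ((m + 1 + 2 * a) * T k -
      (m + 1 + a) ^ 2 / (m + 1) *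
      (fracDiffCoeff a k ^ 2 * ((k + (m + 1)).choose (m + 1) : ℝ)⁻¹))) atTop (𝓝 0) := by
    simp_rw [key]
    have : ∀ n : ℕ, ∑ k ∈ Finset.range n, ((k : ℝ) * T k - (k + 1 : ℕ) * T (k + 1))
        = -(n * T n) := by
      intro n
      rw [Finset.sum_range_sub' (fun k : ℕ => (k : ℝ) * T k)]
      simp
    simp_rw [this]
    simpa using hz.neg
  exact sub_eq_zero.1 (tendsto_nhds_unique hd h0)

/-- Only the term `k = 0` survives, as the binomial is at least `m + 1` for `k ≥ 1`; the sequence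
`c_k²` dominates. -/
lemma tendsto_tsum_fracDiffCoeff_sq_div_choose {a : ℝ} (ha : -(1 / 2) < a) :
    Tendsto (fun m : ℕ => ∑' k, fracDiffCoeff a k ^ 2 * ((k + m).choose m : ℝ)⁻¹)
      atTop (𝓝 1) := by
  have h := tendsto_tsum_of_dominated_convergence (𝓕 := atTop)
    (f := fun m k => fracDiffCoeff a k ^ 2 * ((k + m).choose m : ℝ)⁻¹)
    (g := fun k => if k = 0 then 1 else 0) (summable_fracDiffCoeff_sq ha)
    (fun k => ?_) (Eventually.of_forall fun m k => ?_)
  · simpa using h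
  · rcases k with _ | k
    · simp [fracDiffCoeff_zero]
    · rw [if_neg (Nat.succ_ne_zero k)]
      rw [← mul_zero (fracDiffCoeff a (k + 1) ^ 2)]
      refine Tendsto.const_mul _ (tendsto_inv_atTop_zero.comp ?_)
      refine tendsto_atTop_mono (fun m : ℕ => ?_) tendsto_natCast_atTop_atTop
      have h1 : (m + 1).choose m ≤ (k + 1 + m).choose m :=
        Nat.choose_le_choose m (by omega)
      rw [Nat.choose_succ_self_right] at h1
      exact_mod_cast (Nat.le_succ m).trans h1
  · rw [Real.norm_of_nonneg (by positivity)]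
    exact mul_le_of_le_one_right (by positivity) (inv_choose_le_one k m)

lemma tsum_fracDiffCoeff_sq_eq_prod {a : ℝ} (ha : -(1 / 2) < a) (m : ℕ) :
    ∑' k, fracDiffCoeff a k ^ 2
      = (∏ j ∈ Finset.range m, ((1 + a) + j) ^ 2 / ((j + 1) * ((1 + 2 * a) + j))) *
        ∑' k, fracDiffCoeff a k ^ 2 * ((k + m).choose m : ℝ)⁻¹ := by
  induction m with
  | zero => simp
  | succ m ih =>
    have h := tsum_fracDiffCoeff_sq_div_choose_succ ha m
    have hp : (1 + 2 * a + m : ℝ) ≠ 0 := by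
      have : (0 : ℝ) ≤ m := by positivity
      linarith
    rw [Finset.prod_range_succ, ih, mul_assoc]
    congr 1
    have hm : (m : ℝ) + 1 ≠ 0 := by positivity
    field_simp at h ⊢
    linear_combination h

/-- Iterating the contiguous relation leaves a finite product, which is compared with Euler's limit
formula for `Γ`. -/
lemma tsum_fracDiffCoeff_sq {a : ℝ} (ha : -(1 / 2) < a) :
    ∑' k, fracDiffCoeff a k ^ 2 = Real.Gamma (1 + 2 * a) / Real.Gamma (1 + a) ^ 2 := by
  have hG : Real.Gamma (1 + a) ≠ 0 := (Real.Gamma_pos_of_pos (by linarith)).ne'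
  have h1 := (Real.GammaSeq_tendsto_Gamma (1 + 2 * a)).div
    ((Real.GammaSeq_tendsto_Gamma (1 + a)).pow 2) (pow_ne_zero 2 hG)
  -- The product contains `(n + 1)!`, whereas the quotient of Euler products contains `n * n!`; this
  -- factor reconciles them.
  have h2 : Tendsto (fun n : ℕ => (n : ℝ) / (n + 1)) atTop (𝓝 1) :=
    tendsto_natCast_div_add_atTop 1
  have h3 := (h1.mul h2).mul
    ((tendsto_tsum_fracDiffCoeff_sq_div_choose ha).comp (tendsto_add_atTop_nat 1))
  rw [mul_one, mul_one] at h3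
  refine tendsto_nhds_unique ((tendsto_const_nhds (x := ∑' k, fracDiffCoeff a k ^ 2)).congr' ?_) h3
  filter_upwards [eventually_gt_atTop 0] with n hn
  rw [tsum_fracDiffCoeff_sq_eq_prod ha (n + 1)]
  simp only [Function.comp_apply, Pi.div_apply]
  congr 1
  have hn' : (0 : ℝ) < n := by exact_mod_cast hn
  rw [Finset.prod_div_distrib, Finset.prod_mul_distrib, Finset.prod_pow]
  have hfac : ∏ j ∈ Finset.range (n + 1), ((j : ℝ) + 1) = (n + 1) * n.factorial := by
    have := Finset.prod_range_add_one_eq_factorial (n + 1)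
    rw [Nat.factorial_succ] at this
    exact_mod_cast this
  have hA : ∏ j ∈ Finset.range (n + 1), (1 + a + j : ℝ) ≠ 0 :=
    Finset.prod_ne_zero_iff.2 fun j _ => by
      have : (0 : ℝ) ≤ j := by positivity
      linarith
  have hB : ∏ j ∈ Finset.range (n + 1), (1 + 2 * a + j : ℝ) ≠ 0 :=
    Finset.prod_ne_zero_iff.2 fun j _ => by
      have : (0 : ℝ) ≤ j := by positivity
      linarith
  have hF : (n.factorial : ℝ) ≠ 0 := by positivity
  have hpow : (n : ℝ) ^ (1 + a) * (n : ℝ) ^ (1 + a) = n * (n : ℝ) ^ (1 + 2 * a) := by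
    rw [← Real.rpow_add hn', ← Real.rpow_one_add' hn'.le (by linarith)]
    congr 1; ring
  have hP : (n : ℝ) ^ (1 + a) ≠ 0 := (Real.rpow_pos_of_pos hn' _).ne'
  rw [hfac, Real.GammaSeq, Real.GammaSeq]
  generalize ∏ j ∈ Finset.range (n + 1), (1 + a + j : ℝ) = A at *
  generalize ∏ j ∈ Finset.range (n + 1), (1 + 2 * a + j : ℝ) = B at *
  generalize (n : ℝ) ^ (1 + a) = p at *
  generalize (n : ℝ) ^ (1 + 2 * a) = q at *
  field_simp
  linear_combination hpow

/-! ### Fractional differencing of orthogonal sequences in a Hilbert space -/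

section Hilbert

open scoped InnerProductSpace

variable {E : Type*} [NormedAddCommGroup E] [InnerProductSpace ℝ E]

lemma summable_smul_of_inner_eq [CompleteSpace E] {ι : Type*} [DecidableEq ι] {f : ι → E} {v : ℝ}
    (hv : 0 < v) (hf : ∀ i j, ⟪f i, f j⟫_ℝ = if i = j then v else 0) {a : ι → ℝ}
    (ha : Summable fun i => a i ^ 2) : Summable fun i => a i • f i := by
  have hs : √v ≠ 0 := (Real.sqrt_pos.2 hv).ne'
  have hu : Orthonormal ℝ fun i => (√v)⁻¹ • f i := by
    rw [orthonormal_iff_ite]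
    intro i j
    rw [real_inner_smul_left, real_inner_smul_right, hf]
    split_ifs
    · field_simp
      exact (Real.sq_sqrt hv.le).symm
    · simp
  have h := (hu.orthogonalFamily.summable_iff_norm_sq_summable fun i => √v * a i).2 (by
    simp only [norm_mul, mul_pow, Real.norm_eq_abs, sq_abs]
    exact ha.mul_left _)
  refine h.congr fun i => ?_
  rw [LinearIsometry.toSpanSingleton_apply, smul_smul]
  congr 1
  field_simp

/-- The difference lies both in the closed span and in its orthogonal complement. This identifies
every limit below by its inner products with the innovations. -/
lemma eq_of_forall_inner_eq {ι : Type*} {f : ι → E} {y z : E}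
    (hy : y ∈ (Submodule.span ℝ (range f)).topologicalClosure)
    (hz : z ∈ (Submodule.span ℝ (range f)).topologicalClosure)
    (h : ∀ i, ⟪y, f i⟫_ℝ = ⟪z, f i⟫_ℝ) : y = z := by
  have hd := Submodule.sub_mem _ hy hz
  have ho : y - z ∈ (Submodule.span ℝ (range f))ᗮ := by
    rw [Submodule.mem_orthogonal']
    intro w hw
    induction hw using Submodule.span_induction with
    | mem w hw => obtain ⟨i, rfl⟩ := hw; rw [inner_sub_left, h, sub_self]
    | zero => simp
    | add a b _ _ ha hb => rw [inner_add_right, ha, hb, add_zero]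
    | smul c a _ ha => rw [real_inner_smul_right, ha, mul_zero]
  rw [← Submodule.orthogonal_closure, Submodule.mem_orthogonal] at ho
  exact sub_eq_zero.1 (inner_self_eq_zero.1 (ho _ hd))

/-- The coefficient of `e (n - z)` in the moving average representation of `x n`, extended by zero
to negative `z`. -/
noncomputable def maCoeff (d : ℝ) (z : ℤ) : ℝ := if 0 ≤ z then fracDiffCoeff (-d) z.toNat else 0

lemma maCoeff_natCast (d : ℝ) (k : ℕ) : maCoeff d k = fracDiffCoeff (-d) k := by
  simp [maCoeff]

lemma maCoeff_of_neg (d : ℝ) {z : ℤ} (hz : z < 0) : maCoeff d z = 0 := by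
  simp [maCoeff, hz]

lemma sum_fracDiffCoeff_mul_maCoeff (d : ℝ) (z : ℤ) {N : ℕ} (hN : z < N) :
    ∑ k ∈ Finset.range N, fracDiffCoeff d k * maCoeff d (z - k) = if z = 0 then 1 else 0 := by
  rcases lt_or_ge z 0 with hz | hz
  · rw [if_neg hz.ne]
    exact Finset.sum_eq_zero fun k _ => by rw [maCoeff_of_neg _ (by omega), mul_zero]
  · lift z to ℕ using hz
    have h1 : Finset.range (z + 1) ⊆ Finset.range N := Finset.range_subset_range.2 (by omega)
    rw [← Finset.sum_subset h1]
    · simp only [Nat.cast_eq_zero]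
      rw [← sum_range_fracDiffCoeff_mul d z]
      refine Finset.sum_congr rfl fun k hk => ?_
      rw [← Nat.cast_sub (by simpa [Nat.lt_succ_iff] using hk), maCoeff_natCast]
    · intro k _ hk
      rw [Finset.mem_range] at hk
      rw [maCoeff_of_neg _ (by omega), mul_zero]

variable {e x : ℤ → E} {v d : ℝ}

/-- Causality makes `x n` orthogonal to later innovations. Pairing the equation with `e (n - j)`
therefore leaves only the terms `k ≤ j`, a triangular recursion that the coefficients of `(1 -
L)^(-d)` also satisfy. -/
lemma inner_sub_eq_of_tendsto (he : ∀ i j, ⟪e i, e j⟫_ℝ = if i = j then v else 0)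
    (hcl : ∀ n, x n ∈ (Submodule.span ℝ (e '' Iic n)).topologicalClosure)
    (heq : ∀ n, Tendsto (fun N : ℕ => ∑ k ∈ Finset.range N, fracDiffCoeff d k • x (n - k))
      atTop (𝓝 (e n))) (n m : ℤ) : ⟪x n, e m⟫_ℝ = v * maCoeff d (n - m) := by
  have hfut : ∀ n m : ℤ, n < m → ⟪x n, e m⟫_ℝ = 0 := by
    intro n m hnm
    have ho : e m ∈ (Submodule.span ℝ (e '' Iic n))ᗮ := by
      rw [Submodule.mem_orthogonal]
      intro w hw
      induction hw using Submodule.span_induction with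
      | mem w hw =>
        obtain ⟨i, hi, rfl⟩ := hw
        rw [he, if_neg]
        rintro rfl
        exact absurd hi (not_le.2 hnm)
      | zero => simp
      | add a b _ _ ha hb => rw [inner_add_left, ha, hb, add_zero]
      | smul c a _ ha => rw [real_inner_smul_left, ha, mul_zero]
    rw [← Submodule.orthogonal_closure, Submodule.mem_orthogonal] at ho
    exact ho _ (hcl n)
  have hpast : ∀ j : ℕ, ∀ n : ℤ, ⟪x n, e (n - j)⟫_ℝ = v * fracDiffCoeff (-d) j := by
    intro j
    -- The statement is kept for all `n`, because the recursion refers to smaller lags at shifted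
    -- times.
    induction j using Nat.strong_induction_on with
    | _ j ih =>
      intro n
      have h1 : Tendsto (fun N : ℕ => ⟪∑ k ∈ Finset.range N, fracDiffCoeff d k • x (n - k),
          e (n - j)⟫_ℝ) atTop (𝓝 ⟪e n, e (n - j)⟫_ℝ) :=
        (heq n).inner tendsto_const_nhds
      have h2 : ∀ᶠ N in atTop, ⟪∑ k ∈ Finset.range N, fracDiffCoeff d k • x (n - k),
          e (n - j)⟫_ℝ = ∑ k ∈ Finset.range (j + 1), fracDiffCoeff d k * ⟪x (n - k), e (n - j)⟫_ℝ := by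
        filter_upwards [eventually_ge_atTop (j + 1)] with N hN
        rw [sum_inner, Finset.sum_subset (Finset.range_subset_range.2 hN)]
        · simp_rw [real_inner_smul_left]
        · intro k _ hk
          rw [Finset.mem_range] at hk
          rw [hfut _ _ (by omega), mul_zero]
      have h3 := tendsto_nhds_unique (h1.congr' h2) tendsto_const_nhds
      have h4 := sum_range_fracDiffCoeff_mul d j
      rw [he, Finset.sum_range_succ'] at h3
      rw [Finset.sum_range_succ'] at h4
      have h5 : ∑ k ∈ Finset.range j, fracDiffCoeff d (k + 1) *
          ⟪x (n - (k + 1 : ℕ)), e (n - j)⟫_ℝ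
          = v * ∑ k ∈ Finset.range j, fracDiffCoeff d (k + 1) * fracDiffCoeff (-d) (j - (k + 1)) := by
        rw [Finset.mul_sum]
        refine Finset.sum_congr rfl fun k hk => ?_
        rw [Finset.mem_range] at hk
        have := ih (j - (k + 1)) (by omega) (n - (k + 1 : ℕ))
        rw [show n - (k + 1 : ℕ) - (j - (k + 1) : ℕ) = n - j by omega] at this
        rw [this]; ring
      rw [h5] at h3
      simp only [fracDiffCoeff_zero, one_mul, Nat.cast_zero, sub_zero] at h3 h4
      rcases Nat.eq_zero_or_pos j with rfl | hj
      · simp [fracDiffCoeff_zero] at h3 ⊢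
        linarith
      · rw [if_neg (by omega)] at h3 h4
        linear_combination -h3 - v * h4
  rcases lt_or_ge n m with h | h
  · rw [hfut n m h, maCoeff_of_neg _ (by omega), mul_zero]
  · obtain ⟨j, rfl⟩ : ∃ j : ℕ, m = n - j := ⟨(n - m).toNat, by omega⟩
    rw [hpast, show n - (n - (j : ℤ)) = j by ring, maCoeff_natCast]

/-- A linear process: the moving average with the coefficients of `(1 - L) ^ (-d)`. -/
def IsMovingAverage (e x : ℤ → E) (d : ℝ) : Prop :=
  ∀ n : ℤ, HasSum (fun k : ℕ => fracDiffCoeff (-d) k • e (n - k)) (x n)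

lemma IsMovingAverage.mem_closure (hx : IsMovingAverage e x d) (n : ℤ) :
    x n ∈ (Submodule.span ℝ (range e)).topologicalClosure := by
  refine mem_closure_of_tendsto (hx n).tendsto_sum_nat (Eventually.of_forall fun N => ?_)
  exact Submodule.sum_mem _ fun k _ => Submodule.smul_mem _ _ (Submodule.subset_span ⟨_, rfl⟩)

lemma IsMovingAverage.inner_eq (he : ∀ i j, ⟪e i, e j⟫_ℝ = if i = j then v else 0)
    (hx : IsMovingAverage e x d) (n m : ℤ) : ⟪x n, e m⟫_ℝ = v * maCoeff d (n - m) := by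
  have h : HasSum (fun k : ℕ => ⟪e m, fracDiffCoeff (-d) k • e (n - k)⟫_ℝ) ⟪e m, x n⟫_ℝ :=
    (hx n).mapL (innerSL ℝ (e m))
  rw [real_inner_comm, ← h.tsum_eq]
  simp_rw [real_inner_smul_right, he]
  rcases lt_or_ge n m with hnm | hnm
  · rw [maCoeff_of_neg _ (by omega), mul_zero]
    refine (tsum_congr fun k => ?_).trans tsum_zero
    rw [if_neg (by omega), mul_zero]
  · obtain ⟨j, rfl⟩ : ∃ j : ℕ, m = n - j := ⟨(n - m).toNat, by omega⟩
    rw [tsum_eq_single j, if_pos rfl, show n - (n - (j : ℤ)) = j by ring, maCoeff_natCast, mul_comm]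
    intro k hk
    rw [if_neg (by omega), mul_zero]

lemma exists_isMovingAverage [CompleteSpace E] (hv : 0 < v) (hd : d < 1 / 2)
    (he : ∀ i j, ⟪e i, e j⟫_ℝ = if i = j then v else 0) :
    IsMovingAverage e (fun n => ∑' k : ℕ, fracDiffCoeff (-d) k • e (n - k)) d := by
  intro n
  refine (summable_smul_of_inner_eq hv (fun i j => ?_)
    (summable_fracDiffCoeff_sq (by linarith))).hasSum
  rw [he]
  simp

/-- Uniqueness of the causal solution: it has the same inner products with the innovations as the
moving average, and both lie in their closed span. -/
lemma isMovingAverage_of_tendsto [CompleteSpace E] (hv : 0 < v) (hd : d < 1 / 2)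
    (he : ∀ i j, ⟪e i, e j⟫_ℝ = if i = j then v else 0)
    (hcl : ∀ n, x n ∈ (Submodule.span ℝ (e '' Iic n)).topologicalClosure)
    (heq : ∀ n, Tendsto (fun N : ℕ => ∑ k ∈ Finset.range N, fracDiffCoeff d k • x (n - k))
      atTop (𝓝 (e n))) : IsMovingAverage e x d := by
  have hy := exists_isMovingAverage hv hd he
  have hxy : x = fun n => ∑' k : ℕ, fracDiffCoeff (-d) k • e (n - k) := by
    funext n
    refine eq_of_forall_inner_eq (f := e) ?_ (hy.mem_closure n) fun m => ?_
    · exact Submodule.topologicalClosure_mono (Submodule.span_mono (image_subset_range _ _)) (hcl n)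
    · rw [hy.inner_eq he, inner_sub_eq_of_tendsto he hcl heq]
  rw [hxy]
  exact hy

lemma IsMovingAverage.inner_eq_tsum (he : ∀ i j, ⟪e i, e j⟫_ℝ = if i = j then v else 0)
    (hx : IsMovingAverage e x d) (n m : ℤ) :
    ⟪x n, x m⟫_ℝ = v * ∑' k : ℕ, fracDiffCoeff (-d) k * maCoeff d (m - n + k) := by
  have h : HasSum (fun k : ℕ => ⟪x m, fracDiffCoeff (-d) k • e (n - k)⟫_ℝ) ⟪x m, x n⟫_ℝ :=
    (hx n).mapL (innerSL ℝ (x m))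
  rw [real_inner_comm, ← h.tsum_eq, ← tsum_mul_left]
  refine tsum_congr fun k => ?_
  rw [real_inner_smul_right, hx.inner_eq he, show m - (n - (k : ℤ)) = m - n + k by ring]
  ring

lemma IsMovingAverage.norm_sq (he : ∀ i j, ⟪e i, e j⟫_ℝ = if i = j then v else 0)
    (hx : IsMovingAverage e x d) (n : ℤ) : ‖x n‖ ^ 2 = v * ∑' k : ℕ, fracDiffCoeff (-d) k ^ 2 := by
  rw [← real_inner_self_eq_norm_sq, hx.inner_eq_tsum he]
  congr 1
  refine tsum_congr fun k => ?_
  rw [sub_self, zero_add, maCoeff_natCast, sq]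

lemma IsMovingAverage.inner_add (he : ∀ i j, ⟪e i, e j⟫_ℝ = if i = j then v else 0)
    (hx : IsMovingAverage e x d) (k n m : ℤ) : ⟪x (n + k), x (m + k)⟫_ℝ = ⟪x n, x m⟫_ℝ := by
  rw [hx.inner_eq_tsum he, hx.inner_eq_tsum he, add_sub_add_right_eq_sub]

lemma IsMovingAverage.norm_sum_add (he : ∀ i j, ⟪e i, e j⟫_ℝ = if i = j then v else 0)
    (hx : IsMovingAverage e x d) {ι : Type*} (s : Finset ι) (a : ι → ℝ) (τ : ι → ℤ) (k : ℤ) :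
    ‖∑ i ∈ s, a i • x (τ i + k)‖ = ‖∑ i ∈ s, a i • x (τ i)‖ := by
  rw [← sq_eq_sq₀ (norm_nonneg _) (norm_nonneg _), ← real_inner_self_eq_norm_sq,
    ← real_inner_self_eq_norm_sq]
  simp_rw [sum_inner, inner_sum, real_inner_smul_left, real_inner_smul_right, hx.inner_add he]

/-- The bound does not depend on `n` or `N`, as dominated convergence in `IsMovingAverage.tendsto`
requires. -/
lemma norm_sum_smul_le (hv : 0 < v)
    (he : ∀ i j, ⟪e i, e j⟫_ℝ = if i = j then v else 0) {a : ℕ → ℝ}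
    (ha : Summable fun k => a k ^ 2) (n : ℤ) (N : ℕ) :
    ‖∑ k ∈ Finset.range N, a k • e (n - k)‖ ≤ √(v * ∑' k, a k ^ 2) := by
  refine Real.le_sqrt_of_sq_le ?_
  have h : ‖∑ k ∈ Finset.range N, a k • e (n - k)‖ ^ 2 = v * ∑ k ∈ Finset.range N, a k ^ 2 := by
    rw [← real_inner_self_eq_norm_sq]
    simp_rw [sum_inner, inner_sum, real_inner_smul_left, real_inner_smul_right, he]
    rw [Finset.mul_sum]
    refine Finset.sum_congr rfl fun k hk => ?_
    rw [Finset.sum_eq_single k]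
    · simp; ring
    · intro j _ hj
      rw [if_neg (by omega)]; simp
    · exact fun h => absurd hk h
  rw [h]
  exact mul_le_mul_of_nonneg_left (ha.sum_le_tsum _ fun i _ => sq_nonneg _) hv.le

/-- Convergence depends on the sign of `d`. For `d ≥ 0` the differencing coefficients are absolutely
summable and `‖x m‖` is constant. For `d ≤ 0` they are only known to be square summable, but those
of `(1 - L)^(-d)` are absolutely summable, so the sums are exchanged and the outer one is dominated.
-/
lemma IsMovingAverage.tendsto [CompleteSpace E] (hv : 0 < v) (hd : -(1 / 2) < d) (hd' : d < 1 / 2)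
    (he : ∀ i j, ⟪e i, e j⟫_ℝ = if i = j then v else 0)
    (hx : IsMovingAverage e x d) (n : ℤ) :
    Tendsto (fun N : ℕ => ∑ k ∈ Finset.range N, fracDiffCoeff d k • x (n - k))
      atTop (𝓝 (e n)) := by
  obtain ⟨z, hz⟩ : ∃ z, Tendsto (fun N : ℕ => ∑ k ∈ Finset.range N, fracDiffCoeff d k • x (n - k))
      atTop (𝓝 z) := by
    rcases le_total 0 d with h0 | h0
    · have : Summable fun k : ℕ => fracDiffCoeff d k • x (n - k) := by
        refine Summable.of_norm ?_
        have hn : ∀ m, ‖x m‖ = √(v * ∑' k : ℕ, fracDiffCoeff (-d) k ^ 2) := fun m => by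
          rw [← hx.norm_sq he m, Real.sqrt_sq (norm_nonneg _)]
        simp_rw [norm_smul, hn, Real.norm_eq_abs]
        exact (summable_abs_fracDiffCoeff h0 (by linarith)).mul_right _
      exact ⟨_, this.hasSum.tendsto_sum_nat⟩
    · have hc := summable_fracDiffCoeff_sq hd
      have hsum : ∀ m : ℤ, Summable fun k : ℕ => fracDiffCoeff d k • e (m - k) := fun m =>
        summable_smul_of_inner_eq hv (fun i j => by rw [he]; simp) hc
      have hrep : ∀ N : ℕ, ∑ k ∈ Finset.range N, fracDiffCoeff d k • x (n - k)
          = ∑' j : ℕ, fracDiffCoeff (-d) j •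
            ∑ k ∈ Finset.range N, fracDiffCoeff d k • e (n - j - k) := by
        intro N
        have h := hasSum_sum (s := Finset.range N) fun k _ =>
          (hx (n - k)).const_smul (fracDiffCoeff d k)
        rw [← h.tsum_eq]
        refine tsum_congr fun j => ?_
        rw [Finset.smul_sum]
        refine Finset.sum_congr rfl fun k _ => ?_
        rw [smul_comm, sub_right_comm]
      simp_rw [hrep]
      have hlim := fun j : ℕ => ((hsum (n - j)).hasSum.tendsto_sum_nat).const_smul
        (fracDiffCoeff (-d) j)
      have hb : Summable fun j => |fracDiffCoeff (-d) j| * √(v * ∑' k, fracDiffCoeff d k ^ 2) :=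
        (summable_abs_fracDiffCoeff (a := -d) (by linarith) (by linarith)).mul_right _
      refine ⟨_, tendsto_tsum_of_dominated_convergence hb hlim (Eventually.of_forall fun N j => ?_)⟩
      rw [norm_smul, Real.norm_eq_abs]
      exact mul_le_mul_of_nonneg_left (norm_sum_smul_le hv he hc _ _) (abs_nonneg _)
  suffices z = e n by rwa [← this]
  refine eq_of_forall_inner_eq (f := e) ?_
    (subset_closure (Submodule.subset_span ⟨n, rfl⟩)) fun m => ?_
  · refine (Submodule.isClosed_topologicalClosure _).mem_of_tendsto hz (Eventually.of_forall fun N => ?_)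
    exact Submodule.sum_mem _ fun k _ => Submodule.smul_mem _ _ (hx.mem_closure _)
  -- Paired with `e m`, the partial sums are eventually constant by the convolution identity, which
  -- identifies the limit.
  · refine tendsto_nhds_unique (hz.inner tendsto_const_nhds) (tendsto_const_nhds.congr' ?_)
    filter_upwards [eventually_gt_atTop (n - m).toNat] with N hN
    have h := sum_fracDiffCoeff_mul_maCoeff d (n - m) (N := N) (by omega)
    simp only [sub_eq_zero] at h
    simp_rw [sum_inner, real_inner_smul_left, hx.inner_eq he, he]
    rw [← mul_boole, ← h, Finset.mul_sum]
    refine Finset.sum_congr rfl fun k _ => ?_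
    rw [sub_right_comm]
    ring

/-! ### One-step prediction errors -/

open InnerProductSpace in
lemma exists_eq_gramSchmidt_add (f : ℕ → E) (i : ℕ) :
    ∃ u ∈ Submodule.span ℝ (f '' Iio i), f i = gramSchmidt ℝ f i + u := by
  refine ⟨_, ?_, gramSchmidt_def'' ℝ f i⟩
  rw [← span_gramSchmidt_Iio]
  exact Submodule.sum_mem _ fun j hj => Submodule.smul_mem _ _
    (Submodule.subset_span ⟨j, by simpa using hj, rfl⟩)

open InnerProductSpace in
-- The Gram–Schmidt vector is the error of the best linear prediction of `f i` from its
-- predecessors; Pythagoras shows that no other predictor does better.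
lemma norm_gramSchmidt_le {f : ℕ → E} {i : ℕ} {w : E} (hw : w ∈ Submodule.span ℝ (f '' Iio i)) :
    ‖gramSchmidt ℝ f i‖ ≤ ‖f i + w‖ := by
  obtain ⟨u₀, hu₀, hf⟩ := exists_eq_gramSchmidt_add f i
  obtain ⟨u, hu, hfu⟩ : ∃ u ∈ Submodule.span ℝ (f '' Iio i), f i + w = gramSchmidt ℝ f i + u :=
    ⟨_, Submodule.add_mem _ hu₀ hw, by rw [← add_assoc, ← hf]⟩
  rw [← span_gramSchmidt_Iio] at hu
  have ho : ⟪gramSchmidt ℝ f i, u⟫_ℝ = 0 := by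
    clear hfu
    induction hu using Submodule.span_induction with
    | mem w hw =>
      obtain ⟨j, hj, rfl⟩ := hw
      exact gramSchmidt_orthogonal ℝ f (ne_of_gt hj)
    | zero => simp
    | add a b _ _ ha hb => rw [inner_add_right, ha, hb, add_zero]
    | smul c a _ ha => rw [real_inner_smul_right, ha, mul_zero]
  rw [hfu]
  have := norm_add_sq_eq_norm_sq_add_norm_sq_of_inner_eq_zero _ _ ho
  nlinarith [norm_nonneg (gramSchmidt ℝ f i), norm_nonneg (gramSchmidt ℝ f i + u), norm_nonneg u]

open InnerProductSpace in
-- The innovation `e (i + 1)` is orthogonal to the earlier `x`, so its inner product with the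
-- prediction error is still `v`; Cauchy–Schwarz concludes.
lemma IsMovingAverage.le_norm_gramSchmidt_sq (hv : 0 < v)
    (he : ∀ i j, ⟪e i, e j⟫_ℝ = if i = j then v else 0)
    (hx : IsMovingAverage e x d) (i : ℕ) :
    v ≤ ‖gramSchmidt ℝ (fun i : ℕ => x (i + 1)) i‖ ^ 2 := by
  set f : ℕ → E := fun i : ℕ => x (i + 1) with hf
  have h1 : ⟪gramSchmidt ℝ f i, e (i + 1)⟫_ℝ = v := by
    have h2 : ∀ w ∈ Submodule.span ℝ (f '' Iio i), ⟪w, e (i + 1)⟫_ℝ = 0 := by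
      intro w hw
      induction hw using Submodule.span_induction with
      | mem w hw =>
        obtain ⟨j, hj, rfl⟩ := hw
        rw [mem_Iio] at hj
        rw [hf, hx.inner_eq he, maCoeff_of_neg _ (by omega), mul_zero]
      | zero => simp
      | add a b _ _ ha hb => rw [inner_add_left, ha, hb, add_zero]
      | smul c a _ ha => rw [real_inner_smul_left, ha, mul_zero]
    obtain ⟨u, hu, h3⟩ := exists_eq_gramSchmidt_add f i
    have h4 : ⟪f i, e (i + 1)⟫_ℝ = v := by
      rw [hf, hx.inner_eq he, sub_self]
      simp [maCoeff, fracDiffCoeff_zero]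
    rwa [h3, inner_add_left, h2 u hu, add_zero] at h4
  have h5 := real_inner_mul_inner_self_le (gramSchmidt ℝ f i) (e (i + 1))
  rw [h1, he, if_pos rfl, real_inner_self_eq_norm_sq] at h5
  exact le_of_mul_le_mul_right h5 hv

open InnerProductSpace in
lemma IsMovingAverage.tendsto_norm_gramSchmidt_sq [CompleteSpace E] (hv : 0 < v)
    (hd : -(1 / 2) < d) (hd' : d < 1 / 2)
    (he : ∀ i j, ⟪e i, e j⟫_ℝ = if i = j then v else 0) (hx : IsMovingAverage e x d) :
    Tendsto (fun i => ‖gramSchmidt ℝ (fun i : ℕ => x (i + 1)) i‖ ^ 2) atTop (𝓝 v) := by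
  have h0 : ‖e 0‖ ^ 2 = v := by rw [← real_inner_self_eq_norm_sq, he, if_pos rfl]
  have h1 := ((hx.tendsto hv hd hd' he 0).norm.pow 2).comp (tendsto_add_atTop_nat 1)
  rw [h0] at h1
  refine tendsto_of_tendsto_of_tendsto_of_le_of_le tendsto_const_nhds h1
    (fun i => hx.le_norm_gramSchmidt_sq hv he i) fun i => ?_
  simp only [Function.comp_apply]
  refine pow_le_pow_left₀ (norm_nonneg _) ?_ 2
  -- Stationarity moves the window `x 0, ..., x (-i)` to `x (i + 1), ..., x 1`, where the truncated
  -- equation becomes a competing predictor of `x (i + 1)`.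
  rw [← hx.norm_sum_add he _ _ _ ((i : ℤ) + 1), Finset.sum_range_succ', add_comm]
  simp only [fracDiffCoeff_zero, one_smul, Nat.cast_zero, sub_zero, zero_add]
  refine norm_gramSchmidt_le (f := fun i : ℕ => x (i + 1)) (Submodule.sum_mem _ fun k hk => ?_)
  rw [Finset.mem_range] at hk
  refine Submodule.smul_mem _ _ (Submodule.subset_span ⟨i - (k + 1), ?_, ?_⟩)
  · rw [mem_Iio]; omega
  · simp only
    congr 1
    omega

end Hilbert

/-! ### The Gaussian Hilbert space of an i.i.d. Gaussian sequence -/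

section Gaussian

variable {Ω : Type*} [MeasurableSpace Ω] {P : Measure Ω}

lemma L2_inner_eq_integral (y z : Lp ℝ 2 P) : inner ℝ y z = ∫ ω, y ω * z ω ∂P := by
  rw [L2.inner_def]
  refine integral_congr_ae (Eventually.of_forall fun ω => ?_)
  simp [mul_comm]

lemma L2_norm_sq_eq_integral (y : Lp ℝ 2 P) : ‖y‖ ^ 2 = ∫ ω, y ω ^ 2 ∂P := by
  rw [← real_inner_self_eq_norm_sq, L2_inner_eq_integral]
  simp_rw [sq]

lemma coeFn_sum_smul {ι : Type*} (s : Finset ι) (a : ι → ℝ) (y : ι → Lp ℝ 2 P) :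
    ⇑(∑ i ∈ s, a i • y i) =ᵐ[P] fun ω => ∑ i ∈ s, a i * y i ω := by
  have h : ∀ i ∈ s, ⇑(a i • y i) =ᵐ[P] fun ω => a i * y i ω := fun i _ => by
    filter_upwards [Lp.coeFn_smul (a i) (y i)] with ω hω
    rw [hω]; rfl
  refine (Lp.coeFn_finsetSum s _).trans ?_
  filter_upwards [(eventually_all_finset s).2 h] with ω hω
  rw [Finset.sum_apply]
  exact Finset.sum_congr rfl hω

variable [IsProbabilityMeasure P]

lemma integral_abs_le_norm (y : Lp ℝ 2 P) : ∫ ω, |y ω| ∂P ≤ ‖y‖ := by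
  have h := eLpNorm_le_eLpNorm_of_exponent_le (μ := P) (p := 1) (q := 2) (by norm_num)
    (Lp.aestronglyMeasurable y)
  have h1 : ∫ ω, |y ω| ∂P = (eLpNorm y 1 P).toReal := by
    rw [eLpNorm_one_eq_lintegral_enorm, ← integral_norm_eq_lintegral_enorm
      (Lp.aestronglyMeasurable y)]
    rfl
  rw [h1, Lp.norm_def]
  exact ENNReal.toReal_mono (Lp.eLpNorm_ne_top y) h

lemma integrable_cexp_mul_I {f : Ω → ℝ} (hf : AEStronglyMeasurable f P) :
    Integrable (fun ω => Complex.exp (f ω * Complex.I)) P := by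
  refine Integrable.of_bound (C := 1) ?_ (Eventually.of_forall fun ω => ?_)
  · exact (by fun_prop : Continuous fun x : ℝ => Complex.exp (x * Complex.I)).comp_aestronglyMeasurable hf
  · rw [Complex.norm_exp_ofReal_mul_I]

lemma norm_cexp_sub_cexp_le (a b : ℝ) :
    ‖Complex.exp (a * Complex.I) - Complex.exp (b * Complex.I)‖ ≤ |a - b| := by
  have h : Complex.exp (a * Complex.I) - Complex.exp (b * Complex.I)
      = Complex.exp (b * Complex.I) * (Complex.exp (Complex.I * ((a - b : ℝ) : ℂ)) - 1) := by
    rw [mul_sub, ← Complex.exp_add, mul_one]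
    congr 2
    push_cast
    ring
  rw [h, norm_mul, Complex.norm_exp_ofReal_mul_I, one_mul]
  exact Real.norm_exp_I_mul_ofReal_sub_one_le

lemma continuous_integral_cexp :
    Continuous fun y : Lp ℝ 2 P => ∫ ω, Complex.exp (y ω * Complex.I) ∂P := by
  refine LipschitzWith.continuous (K := 1) (LipschitzWith.of_dist_le_mul fun y z => ?_)
  rw [NNReal.coe_one, one_mul, dist_eq_norm, dist_eq_norm, ← integral_sub
    (integrable_cexp_mul_I (Lp.aestronglyMeasurable y))
    (integrable_cexp_mul_I (Lp.aestronglyMeasurable z))]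
  refine (norm_integral_le_integral_norm _).trans (le_trans ?_ (integral_abs_le_norm (y - z)))
  refine integral_mono_of_nonneg (Eventually.of_forall fun ω => norm_nonneg _)
    ((Lp.memLp (y - z)).integrable (by norm_num)).abs ?_
  filter_upwards [Lp.coeFn_sub y z] with ω hω
  rw [hω]
  exact norm_cexp_sub_cexp_le _ _

lemma hasGaussianLaw_of_mem_span {ι : Type*} {e : ι → Lp ℝ 2 P}
    (hind : iIndepFun (fun i => ⇑(e i)) P) {v : ℝ≥0}
    (hlaw : ∀ i, HasLaw (e i) (gaussianReal 0 v) P) {y : Lp ℝ 2 P}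
    (hy : y ∈ Submodule.span ℝ (range e)) : HasGaussianLaw y P ∧ ∫ ω, y ω ∂P = 0 := by
  obtain ⟨c, rfl⟩ := (Finsupp.mem_span_range_iff_exists_finsupp).1 hy
  rw [Finsupp.sum]
  have hae := coeFn_sum_smul c.support c e
  have he0 : ∀ i, ∫ ω, e i ω ∂P = 0 := fun i => by
    rw [(hlaw i).integral_eq]; simp
  constructor
  · have h1 : HasGaussianLaw (fun ω (i : c.support) => e i ω) P :=
      iIndepFun.hasGaussianLaw (fun i => (hlaw i).hasGaussianLaw)
        (hind.precomp Subtype.val_injective)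
    have h2 := h1.map_fun (∑ i : c.support, c i • ContinuousLinearMap.proj (R := ℝ) i)
    refine h2.congr ?_
    filter_upwards [hae] with ω hω
    rw [hω, ← Finset.sum_coe_sort c.support (fun i => c i * e i ω)]
    simp
  · rw [integral_congr_ae hae, integral_finsetSum]
    · simp_rw [integral_const_mul, he0]
      simp
    · exact fun i _ => ((Lp.memLp (e i)).integrable (by norm_num)).const_mul _

/-- Both sides are continuous in `L²`, so the Gaussian formula extends from finite combinations to
the closed span. -/
lemma integral_cexp_eq {ι : Type*} {e : ι → Lp ℝ 2 P}
    (hind : iIndepFun (fun i => ⇑(e i)) P) {v : ℝ≥0}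
    (hlaw : ∀ i, HasLaw (e i) (gaussianReal 0 v) P) {y : Lp ℝ 2 P}
    (hy : y ∈ (Submodule.span ℝ (range e)).topologicalClosure) :
    ∫ ω, Complex.exp (y ω * Complex.I) ∂P = Complex.exp (-(‖y‖ ^ 2 : ℝ) / 2) := by
  have hclosed : IsClosed {y : Lp ℝ 2 P |
      ∫ ω, Complex.exp (y ω * Complex.I) ∂P = Complex.exp (-(‖y‖ ^ 2 : ℝ) / 2)} :=
    isClosed_eq continuous_integral_cexp (by fun_prop)
  refine closure_minimal (fun z hz => ?_) hclosed hy
  obtain ⟨hG, h0⟩ := hasGaussianLaw_of_mem_span hind hlaw hz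
  have h := hG.charFun_map_eq 1
  rw [charFun_apply, integral_map hG.aemeasurable (by fun_prop)] at h
  have hvar : Var[z; P] = ‖z‖ ^ 2 := by
    rw [variance_of_integral_eq_zero hG.aemeasurable h0, L2_norm_sq_eq_integral]
  simpa [h0, hvar, neg_div] using h

lemma charFunDual_map_eq {ι κ : Type*} [Fintype κ] {e : ι → Lp ℝ 2 P}
    (hind : iIndepFun (fun i => ⇑(e i)) P) {v : ℝ≥0}
    (hlaw : ∀ i, HasLaw (e i) (gaussianReal 0 v) P) {y : κ → Lp ℝ 2 P}
    (hy : ∀ i, y i ∈ (Submodule.span ℝ (range e)).topologicalClosure)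
    (L : StrongDual ℝ (κ → ℝ)) [DecidableEq κ] :
    charFunDual (P.map fun ω i => y i ω) L
      = Complex.exp (-(‖∑ i, L (Pi.single i 1) • y i‖ ^ 2 : ℝ) / 2) := by
  rw [charFunDual_apply, integral_map (by fun_prop) (by fun_prop),
    ← integral_cexp_eq hind hlaw (Submodule.sum_mem _ fun i _ => Submodule.smul_mem _ _ (hy i))]
  refine integral_congr_ae ?_
  filter_upwards [coeFn_sum_smul Finset.univ (fun i => L (Pi.single i 1)) y] with ω hω
  rw [hω]
  congr 3
  conv_lhs => rw [← Finset.univ_sum_single (fun i => y i ω)]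
  rw [map_sum]
  refine Finset.sum_congr rfl fun i _ => ?_
  rw [show (Pi.single i (y i ω) : κ → ℝ) = y i ω • Pi.single i 1 by
    rw [← Pi.single_smul', smul_eq_mul, mul_one], map_smul, smul_eq_mul, mul_comm]

/-- A centred Gaussian vector is determined by the variances of its linear combinations
(Cramér–Wold); this yields stationarity. -/
lemma map_eq_map_of_norm_eq {ι κ : Type*} [Fintype κ] {e : ι → Lp ℝ 2 P}
    (hind : iIndepFun (fun i => ⇑(e i)) P) {v : ℝ≥0}
    (hlaw : ∀ i, HasLaw (e i) (gaussianReal 0 v) P) {y z : κ → Lp ℝ 2 P}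
    (hy : ∀ i, y i ∈ (Submodule.span ℝ (range e)).topologicalClosure)
    (hz : ∀ i, z i ∈ (Submodule.span ℝ (range e)).topologicalClosure)
    (h : ∀ a : κ → ℝ, ‖∑ i, a i • y i‖ = ‖∑ i, a i • z i‖) :
    P.map (fun ω i => y i ω) = P.map (fun ω i => z i ω) := by
  classical
  refine Measure.ext_of_charFunDual (funext fun L => ?_)
  rw [charFunDual_map_eq hind hlaw hy, charFunDual_map_eq hind hlaw hz, h]

lemma map_eq_pi_gaussianReal {ι κ : Type*} [Fintype κ] {e : ι → Lp ℝ 2 P}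
    (hind : iIndepFun (fun i => ⇑(e i)) P) {v : ℝ≥0}
    (hlaw : ∀ i, HasLaw (e i) (gaussianReal 0 v) P) {z : κ → Lp ℝ 2 P}
    (hz : ∀ i, z i ∈ (Submodule.span ℝ (range e)).topologicalClosure)
    (horth : ∀ i j, i ≠ j → inner ℝ (z i) (z j) = 0) {w : κ → ℝ≥0}
    (hw : ∀ i, ‖z i‖ ^ 2 = w i) :
    P.map (fun ω i => z i ω) = Measure.pi fun i => gaussianReal 0 (w i) := by
  classical
  refine Measure.ext_of_charFunDual (funext fun L => ?_)
  rw [charFunDual_map_eq hind hlaw hz, charFunDual_pi]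
  have h1 : ∀ i, charFunDual (gaussianReal 0 (w i)) (L.comp (.single ℝ (fun _ => ℝ) i))
      = Complex.exp (-((w i : ℝ) * L (Pi.single i 1) ^ 2 : ℝ) / 2) := by
    intro i
    have h2 : charFunDual (gaussianReal 0 (w i)) (L.comp (.single ℝ (fun _ => ℝ) i))
        = charFun (gaussianReal 0 (w i)) (L (Pi.single i 1)) := by
      rw [charFunDual_apply, charFun_apply_real]
      refine integral_congr_ae (Eventually.of_forall fun x => ?_)
      have : L.comp (.single ℝ (fun _ => ℝ) i) x = L (Pi.single i 1) * x := by
        have : (Pi.single i x : κ → ℝ) = x • Pi.single i 1 := by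
          rw [← Pi.single_smul', smul_eq_mul, mul_one]
        simp [this, mul_comm]
      simp only [this]
      push_cast
      rfl
    rw [h2, charFun_gaussianReal]
    congr 1
    push_cast
    ring
  simp_rw [h1]
  rw [← Complex.exp_sum]
  congr 1
  rw [← Finset.sum_div, ← real_inner_self_eq_norm_sq]
  congr 1
  rw [Finset.sum_neg_distrib, neg_inj, ← Complex.ofReal_sum]
  congr 1
  simp_rw [sum_inner, inner_sum, real_inner_smul_left, real_inner_smul_right]
  refine Finset.sum_congr rfl fun i _ => ?_
  rw [Finset.sum_eq_single i]
  · rw [real_inner_self_eq_norm_sq, hw]; ring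
  · intro j _ hj
    rw [horth i j hj.symm]; ring
  · simp

end Gaussian

/-! ### Entropy of nondegenerate Gaussian vectors -/

lemma pi_gaussianReal_eq_withDensity {κ : Type*} [Fintype κ] {w : κ → ℝ≥0} (hw : ∀ i, w i ≠ 0) :
    Measure.pi (fun i => gaussianReal 0 (w i))
      = volume.withDensity fun x => ENNReal.ofReal (∏ i, gaussianPDFReal 0 (w i) (x i)) := by
  refine Measure.pi_eq fun s hs => ?_
  have hint : ∀ i, Integrable (gaussianPDFReal 0 (w i)) (volume.restrict (s i)) := fun i =>
    (integrable_gaussianPDFReal 0 (w i)).restrict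
  rw [withDensity_apply _ (MeasurableSet.univ_pi hs), volume_pi, Measure.restrict_pi_pi,
    ← ofReal_integral_eq_lintegral_ofReal (Integrable.fintype_prod hint)
      (Eventually.of_forall fun x => Finset.prod_nonneg fun i _ => gaussianPDFReal_nonneg _ _ _),
    integral_fintype_prod_eq_prod, ENNReal.ofReal_prod_of_nonneg
      (fun i _ => integral_nonneg fun x => gaussianPDFReal_nonneg _ _ _)]
  exact Finset.prod_congr rfl fun i _ => (gaussianReal_apply_eq_integral 0 (hw i) (s i)).symm

lemma log_gaussianPDFReal {w : ℝ≥0} (hw : w ≠ 0) (x : ℝ) :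
    Real.log (gaussianPDFReal 0 w x) = -(1 / 2 * Real.log (2 * Real.pi * w)) - x ^ 2 / (2 * w) := by
  have hw' : (0 : ℝ) < w := by exact_mod_cast pos_iff_ne_zero.2 hw
  have h2 : (0 : ℝ) < 2 * Real.pi * w := by positivity
  rw [gaussianPDFReal, Real.log_mul (by positivity) (by positivity), Real.log_inv,
    Real.log_sqrt h2.le, Real.log_exp, sub_zero]
  ring

lemma map_withDensity_mulVec {κ : Type*} [Fintype κ] [DecidableEq κ] {M : Matrix κ κ ℝ}
    (hM : M.det = 1) {g : (κ → ℝ) → ℝ≥0∞} (hg : Measurable g) :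
    (volume.withDensity g).map M.mulVec = volume.withDensity fun y => g (M⁻¹.mulVec y) := by
  have hcont : Continuous M.mulVec := by fun_prop
  have hcont' : Continuous M⁻¹.mulVec := by fun_prop
  have hmp : MeasurePreserving M.mulVec (volume : Measure (κ → ℝ)) volume := by
    refine ⟨hcont.measurable, ?_⟩
    have := Real.map_matrix_volume_pi_eq_smul_volume_pi (M := M) (by rw [hM]; exact one_ne_zero)
    rw [hM, inv_one, abs_one, ENNReal.ofReal_one, one_smul] at this
    exact this
  have hinv : ∀ x, M⁻¹.mulVec (M.mulVec x) = x := fun x => by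
    rw [Matrix.mulVec_mulVec, Matrix.nonsing_inv_mul _ (by rw [hM]; exact isUnit_one),
      Matrix.one_mulVec]
  ext s hs
  rw [Measure.map_apply hcont.measurable hs, withDensity_apply _ (hcont.measurable hs),
    withDensity_apply _ hs, ← hmp.setLIntegral_comp_preimage hs
      (f := fun y => g (M⁻¹.mulVec y)) (hg.comp hcont'.measurable)]
  simp_rw [hinv]

/-- The entropy is `-E log f(Y)`. As `M` preserves volume, `f(Y)` is the product density evaluated
at `Z`, so the matrix drops out. -/
lemma entropy_of_map_eq_pi_gaussianReal {Ω κ : Type*} [MeasurableSpace Ω] {P : Measure Ω}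
    [IsProbabilityMeasure P] [Fintype κ] [DecidableEq κ] {Y Z : Ω → κ → ℝ} {M : Matrix κ κ ℝ}
    (hM : M.det = 1) (hZm : AEMeasurable Z P) (hYZ : Y =ᵐ[P] fun ω => M.mulVec (Z ω))
    {w : κ → ℝ≥0} (hw : ∀ i, w i ≠ 0)
    (hZ : P.map Z = Measure.pi fun i => gaussianReal 0 (w i))
    (hint : ∀ i, Integrable (fun ω => Z ω i ^ 2) P) (hsq : ∀ i, ∫ ω, Z ω i ^ 2 ∂P = w i) :
    HasFiniteEntropy P Y ∧
      differentialEntropy P Y = ∑ i, 1 / 2 * Real.log (2 * Real.pi * Real.exp 1 * w i) := by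
  set g : (κ → ℝ) → ℝ := fun x => ∏ i, gaussianPDFReal 0 (w i) (x i) with hg
  have hgm : Measurable g := Finset.measurable_prod _ fun i _ =>
    (measurable_gaussianPDFReal 0 (w i)).comp (measurable_pi_apply i)
  have hgpos : ∀ x, 0 < g x := fun x =>
    Finset.prod_pos fun i _ => gaussianPDFReal_pos _ _ _ (hw i)
  have hcont : Continuous M.mulVec := by fun_prop
  have hcont' : Continuous M⁻¹.mulVec := by fun_prop
  have hYm : AEMeasurable Y P := (hcont.measurable.comp_aemeasurable hZm).congr hYZ.symm
  have hYlaw : P.map Y = volume.withDensity fun y => ENNReal.ofReal (g (M⁻¹.mulVec y)) := by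
    rw [Measure.map_congr hYZ, ← Function.comp_def M.mulVec Z,
      ← AEMeasurable.map_map_of_aemeasurable hcont.measurable.aemeasurable hZm, hZ,
      pi_gaussianReal_eq_withDensity hw, map_withDensity_mulVec hM hgm.ennreal_ofReal]
  have hfm : Measurable fun y => ENNReal.ofReal (g (M⁻¹.mulVec y)) :=
    (hgm.comp hcont'.measurable).ennreal_ofReal
  have hpdf : HasPDF Y P volume := hasPDF_of_map_eq_withDensity hYm _ hfm.aemeasurable hYlaw
  have hpdfm : AEStronglyMeasurable (fun y => Real.log (pdf Y P volume y).toReal) volume :=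
    (Real.measurable_log.comp (measurable_pdf Y P volume).ennreal_toReal).aestronglyMeasurable
  have hae : pdf Y P volume =ᵐ[volume] fun y => ENNReal.ofReal (g (M⁻¹.mulVec y)) :=
    pdf.eq_of_map_eq_withDensity _ hfm.aemeasurable |>.1 hYlaw
  have hinv : ∀ x, M⁻¹.mulVec (M.mulVec x) = x := fun x => by
    rw [Matrix.mulVec_mulVec, Matrix.nonsing_inv_mul _ (by rw [hM]; exact isUnit_one),
      Matrix.one_mulVec]
  have hlog : (fun ω => Real.log (pdf Y P volume (Y ω)).toReal) =ᵐ[P]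
      fun ω => ∑ i, (-(1 / 2 * Real.log (2 * Real.pi * w i)) - Z ω i ^ 2 / (2 * w i)) := by
    have h1 := ae_of_ae_map hYm (hpdf.absolutelyContinuous'.ae_le hae)
    filter_upwards [h1, hYZ] with ω h1 h2
    rw [h1, h2, hinv, ENNReal.toReal_ofReal (hgpos _).le, hg,
      Real.log_prod (fun i _ => (gaussianPDFReal_pos _ _ _ (hw i)).ne')]
    exact Finset.sum_congr rfl fun i _ => log_gaussianPDFReal (hw i) _
  have hI : ∀ i, Integrable (fun ω => -(1 / 2 * Real.log (2 * Real.pi * w i))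
      - Z ω i ^ 2 / (2 * w i)) P := fun i => (integrable_const _).sub ((hint i).div_const _)
  refine ⟨⟨hpdf, (pdf.integrable_pdf_smul_iff hpdfm).2
    ((integrable_finsetSum _ fun i _ => hI i).congr hlog.symm)⟩, ?_⟩
  have h3 : ∫ x, (pdf Y P volume x).toReal • Real.log (pdf Y P volume x).toReal
      = ∫ ω, Real.log (pdf Y P volume (Y ω)).toReal ∂P := pdf.integral_pdf_smul hpdfm
  simp only [smul_eq_mul] at h3
  rw [differentialEntropy, h3, integral_congr_ae hlog, integral_finsetSum _ fun i _ => hI i,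
    ← Finset.sum_neg_distrib]
  refine Finset.sum_congr rfl fun i _ => ?_
  have hwi : (0 : ℝ) < w i := by exact_mod_cast pos_iff_ne_zero.2 (hw i)
  -- The expectation of `Z_i² / (2 w_i)` is `1/2`, which accounts for the factor `e` inside the
  -- logarithm.
  rw [integral_sub (integrable_const _) ((hint i).div_const _), integral_div, hsq,
    mul_right_comm (2 * Real.pi), Real.log_mul (by positivity) (Real.exp_ne_zero 1), Real.log_exp]
  simp only [integral_const, probReal_univ, one_smul]
  field_simp
  ring

/-! ### ARFIMA processes as moving averages in `L²` -/

section LinearProcess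

variable {Ω : Type*} [MeasurableSpace Ω] {P : Measure Ω}

/-- Translates the mean-square conditions of `IsARFIMA` into distances in `Lp`. -/
lemma eLpNorm_sum_sub {ι : Type*} (s : Finset ι) (a : ι → ℝ) {X : ι → Ω → ℝ} {Y : Ω → ℝ}
    (hX : ∀ i, MemLp (X i) 2 P) (hY : MemLp Y 2 P) :
    eLpNorm (fun ω => ∑ i ∈ s, a i * X i ω - Y ω) 2 P
      = ‖∑ i ∈ s, a i • (hX i).toLp - hY.toLp‖ₑ := by
  rw [Lp.enorm_def]
  refine eLpNorm_congr_ae ?_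
  filter_upwards [Lp.coeFn_sub (∑ i ∈ s, a i • (hX i).toLp) hY.toLp,
    coeFn_sum_smul s a (fun i => (hX i).toLp), hY.coeFn_toLp,
    (eventually_all_finset s).2 fun i _ => (hX i).coeFn_toLp] with ω h1 h2 h3 h4
  rw [h1, Pi.sub_apply, h2, h3]
  congr 1
  exact Finset.sum_congr rfl fun i hi => by rw [h4 i hi]

lemma memLp_of_hasLaw_gaussianReal {Y : Ω → ℝ} {v : ℝ≥0} (h : HasLaw Y (gaussianReal 0 v) P) :
    MemLp Y 2 P :=
  h.hasGaussianLaw.memLp_two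


variable {X ε : ℤ → Ω → ℝ} {d : ℝ} {v : ℝ≥0}

lemma inner_toLp_eq (hind : iIndepFun ε P) (hlaw : ∀ n, HasLaw (ε n) (gaussianReal 0 v) P)
    (i j : ℤ) : inner ℝ (memLp_of_hasLaw_gaussianReal (hlaw i)).toLp
      (memLp_of_hasLaw_gaussianReal (hlaw j)).toLp = if i = j then (v : ℝ) else 0 := by
  have h0 : ∀ n, ∫ ω, ε n ω ∂P = 0 := fun n => by rw [(hlaw n).integral_eq]; simp
  have h1 : ∀ i, (memLp_of_hasLaw_gaussianReal (hlaw i)).toLp =ᵐ[P] ε i := fun i =>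
    MemLp.coeFn_toLp _
  have h2 : inner ℝ (memLp_of_hasLaw_gaussianReal (hlaw i)).toLp
      (memLp_of_hasLaw_gaussianReal (hlaw j)).toLp = ∫ ω, ε i ω * ε j ω ∂P := by
    rw [L2_inner_eq_integral]
    refine integral_congr_ae ?_
    filter_upwards [h1 i, h1 j] with ω hi hj
    rw [hi, hj]
  rw [h2]
  split_ifs with hij
  · subst hij
    have h3 : Var[ε i; P] = v := by rw [(hlaw i).variance_eq]; simp
    rw [variance_of_integral_eq_zero (hlaw i).aemeasurable (h0 i)] at h3
    simpa [sq] using h3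
  · rw [(hind.indepFun hij).integral_fun_mul_eq_mul_integral
      (hlaw i).aemeasurable.aestronglyMeasurable (hlaw j).aemeasurable.aestronglyMeasurable, h0,
      zero_mul]

lemma iIndepFun_toLp (hind : iIndepFun ε P) (hlaw : ∀ n, HasLaw (ε n) (gaussianReal 0 v) P) :
    iIndepFun (fun n => ⇑((memLp_of_hasLaw_gaussianReal (hlaw n)).toLp)) P :=
  hind.congr fun _ => (MemLp.coeFn_toLp _).symm

lemma hasLaw_toLp (hlaw : ∀ n, HasLaw (ε n) (gaussianReal 0 v) P) (n : ℤ) :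
    HasLaw (memLp_of_hasLaw_gaussianReal (hlaw n)).toLp (gaussianReal 0 v) P :=
  (hlaw n).congr (MemLp.coeFn_toLp _)

lemma toLp_mem_closure (hlaw : ∀ n, HasLaw (ε n) (gaussianReal 0 v) P)
    (h : IsARFIMA P X ε d v) (n : ℤ) : (h.memLp n).toLp ∈
      (Submodule.span ℝ ((fun n => (memLp_of_hasLaw_gaussianReal (hlaw n)).toLp) ''
        Iic n)).topologicalClosure := by
  refine EMetric.mem_closure_iff.2 fun δ hδ => ?_
  obtain ⟨N, c, hc⟩ := h.causal n δ hδ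
  refine ⟨∑ j ∈ Finset.range N, c j • (memLp_of_hasLaw_gaussianReal (hlaw (n - j))).toLp,
    Submodule.sum_mem _ fun j _ => Submodule.smul_mem _ _
      (Submodule.subset_span ⟨n - j, by simp, rfl⟩), ?_⟩
  rw [edist_comm, edist_eq_enorm_sub, ← eLpNorm_sum_sub (Finset.range N) c
    (fun j => memLp_of_hasLaw_gaussianReal (hlaw (n - j))) (h.memLp n)]
  rwa [← eLpNorm_neg, show -(fun ω => ∑ j ∈ Finset.range N, c j * ε (n - j) ω - X n ω)
    = fun ω => X n ω - ∑ j ∈ Finset.range N, c j * ε (n - j) ω by ext; simp]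

lemma IsARFIMA.isMovingAverage (h : IsARFIMA P X ε d v) (hv : 0 < v) :
    IsMovingAverage (fun n => (memLp_of_hasLaw_gaussianReal (h.law n)).toLp)
      (fun n => (h.memLp n).toLp) d := by
  refine isMovingAverage_of_tendsto (v := v) (by exact_mod_cast hv) h.lt_half
    (inner_toLp_eq h.indep h.law) (toLp_mem_closure h.law h) fun n => ?_
  have := h.equation n
  rw [tendsto_iff_edist_tendsto_0]
  refine this.congr fun N => ?_
  rw [edist_eq_enorm_sub]
  exact eLpNorm_sum_sub (Finset.range N) (fracDiffCoeff d) (fun k => h.memLp (n - k))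
    (memLp_of_hasLaw_gaussianReal (h.law n))

variable [IsProbabilityMeasure P]

lemma integral_eq_zero_of_mem_closure {ι : Type*} {e : ι → Lp ℝ 2 P}
    (he : ∀ i, ∫ ω, e i ω ∂P = 0) {y : Lp ℝ 2 P}
    (hy : y ∈ (Submodule.span ℝ (range e)).topologicalClosure) : ∫ ω, y ω ∂P = 0 := by
  have hint : ∀ y : Lp ℝ 2 P, Integrable y P := fun y => (Lp.memLp y).integrable (by norm_num)
  have hcont : Continuous fun y : Lp ℝ 2 P => ∫ ω, y ω ∂P := by
    refine LipschitzWith.continuous (K := 1) (LipschitzWith.of_dist_le_mul fun y z => ?_)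
    rw [NNReal.coe_one, one_mul, dist_eq_norm, dist_eq_norm, ← integral_sub (hint y) (hint z)]
    refine (norm_integral_le_integral_norm _).trans (le_of_eq_of_le ?_ (integral_abs_le_norm (y - z)))
    refine integral_congr_ae ?_
    filter_upwards [Lp.coeFn_sub y z] with ω hω
    rw [hω]; rfl
  refine closure_minimal (fun z hz => ?_) (isClosed_eq hcont continuous_const) hy
  obtain ⟨c, rfl⟩ := (Finsupp.mem_span_range_iff_exists_finsupp).1 hz
  rw [Finsupp.sum, mem_ofPred_eq, integral_congr_ae (coeFn_sum_smul c.support c e),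
    integral_finsetSum _ fun i _ => (hint (e i)).const_mul _]
  simp_rw [integral_const_mul, he]
  simp

lemma variance_eq_norm_toLp_sq {Y : Ω → ℝ} (hY : MemLp Y 2 P)
    (hlaw : ∀ n, HasLaw (ε n) (gaussianReal 0 v) P)
    (hcl : hY.toLp ∈ (Submodule.span ℝ
      (range fun n => (memLp_of_hasLaw_gaussianReal (hlaw n)).toLp)).topologicalClosure) :
    Var[Y; P] = ‖hY.toLp‖ ^ 2 := by
  have h0 : ∫ ω, Y ω ∂P = 0 := by
    rw [← integral_congr_ae hY.coeFn_toLp]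
    refine integral_eq_zero_of_mem_closure (fun n => ?_) hcl
    rw [(hasLaw_toLp hlaw n).integral_eq]; simp
  rw [variance_of_integral_eq_zero hY.aestronglyMeasurable.aemeasurable h0,
    L2_norm_sq_eq_integral]
  refine integral_congr_ae ?_
  filter_upwards [hY.coeFn_toLp] with ω hω
  simp [hω]

/-- If `v = 0`, all innovations vanish in `L²`, and causality then makes `X 0` vanish too. -/
lemma IsARFIMA.pos (h : IsARFIMA P X ε d v) (hX : Var[X 0; P] ≠ 0) : 0 < v := by
  rw [pos_iff_ne_zero]
  rintro rfl
  apply hX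
  have hcl := toLp_mem_closure h.law h 0
  rw [variance_eq_norm_toLp_sq (h.memLp 0) h.law
    (Submodule.topologicalClosure_mono (Submodule.span_mono (image_subset_range _ _)) hcl)]
  have he : ∀ n, (memLp_of_hasLaw_gaussianReal (h.law n)).toLp = 0 := fun n => by
    rw [← inner_self_eq_zero (𝕜 := ℝ), inner_toLp_eq h.indep h.law]
    simp
  have hbot : Submodule.span ℝ ((fun n => (memLp_of_hasLaw_gaussianReal (h.law n)).toLp) ''
      Iic (0 : ℤ)) ≤ ⊥ := by
    rw [Submodule.span_le]
    rintro _ ⟨n, _, rfl⟩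
    exact he n
  have h1 := Submodule.topologicalClosure_minimal _ hbot (by
    rw [Submodule.bot_coe]; exact isClosed_singleton) hcl
  rw [Submodule.mem_bot] at h1
  rw [h1]; simp

lemma IsARFIMA.variance_eq (h : IsARFIMA P X ε d v) (hv : 0 < v) :
    Var[X 0; P] = v * (Real.Gamma (1 - 2 * d) / Real.Gamma (1 - d) ^ 2) := by
  have hma := h.isMovingAverage hv
  rw [variance_eq_norm_toLp_sq (h.memLp 0) h.law (hma.mem_closure 0),
    hma.norm_sq (inner_toLp_eq h.indep h.law) 0,
    tsum_fracDiffCoeff_sq (by linarith [h.lt_half])]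
  ring_nf

/-! ### The entropy rate -/

open InnerProductSpace in
lemma IsARFIMA.entropy (h : IsARFIMA P X ε d v) (hv : 0 < v) (n : ℕ) :
    HasFiniteEntropy P (initialSegment X n) ∧
      differentialEntropy P (initialSegment X n) = ∑ i ∈ Finset.range n, 1 / 2 *
        Real.log (2 * Real.pi * Real.exp 1 *
          ‖gramSchmidt ℝ (fun i : ℕ => (h.memLp (i + 1)).toLp) i‖ ^ 2) := by
  have hv' : (0 : ℝ) < v := by exact_mod_cast hv
  have hma := h.isMovingAverage hv
  have he := inner_toLp_eq h.indep h.law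
  set f : ℕ → Lp ℝ 2 P := fun i : ℕ => (h.memLp (i + 1)).toLp with hf
  set g := gramSchmidt ℝ f with hg
  have hgcl : ∀ i, g i ∈ (Submodule.span ℝ
      (range fun n => (memLp_of_hasLaw_gaussianReal (h.law n)).toLp)).topologicalClosure := by
    intro i
    have h1 := gramSchmidt_mem_span ℝ f (le_refl i)
    refine (Submodule.span_le.2 ?_) h1
    rintro _ ⟨j, _, rfl⟩
    exact hma.mem_closure _
  have hpos : ∀ i, 0 < ‖g i‖ ^ 2 := fun i => hv'.trans_le (hma.le_norm_gramSchmidt_sq hv' he i)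
  -- The Gram–Schmidt change of basis: unit lower triangular, taking the prediction errors `g` back
  -- to the process.
  set M : Matrix (Fin n) (Fin n) ℝ := Matrix.of fun i j =>
    if j < i then inner ℝ (g j) (f i) / ‖g j‖ ^ 2 else if i = j then 1 else 0 with hM
  have hdet : M.det = 1 := by
    rw [Matrix.det_of_isLowerTriangular M]
    · exact Finset.prod_eq_one fun i _ => by simp [hM]
    · intro i j hij
      have hij' : i < j := hij
      simp [hM, hij'.not_gt, hij'.ne]
  have hYZ : initialSegment X n =ᵐ[P] fun ω => M.mulVec fun j => g j ω := by
    have hi : ∀ i : Fin n, ∀ᵐ ω ∂P, X ((i : ℤ) + 1) ω = ∑ j, M i j * g j ω := by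
      intro i
      have h1 : f i = ∑ j, M i j • g j := by
        have hdef := gramSchmidt_def'' ℝ f i
        rw [Fin.sum_univ_eq_sum_range (fun j => (if j < (i : ℕ) then
          inner ℝ (g j) (f i) / ‖g j‖ ^ 2 else if (i : ℕ) = j then 1 else 0) • g j) n |> fun h =>
            (Finset.sum_congr rfl fun j _ => by simp [hM, Fin.ext_iff]).trans h]
        have hsub : Finset.range (i + 1) ⊆ Finset.range n :=
          Finset.range_subset_range.2 i.isLt
        rw [← Finset.sum_subset hsub, Finset.sum_range_succ]
        · simp only [lt_irrefl, if_false, if_true, one_smul]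
          rw [add_comm]
          refine hdef.trans (congrArg (g i + ·) ?_)
          rw [Nat.Iio_eq_range]
          refine Finset.sum_congr rfl fun j hj => ?_
          rw [if_pos (Finset.mem_range.1 hj)]
          rfl
        · intro j _ hj
          rw [Finset.mem_range] at hj
          rw [if_neg (by omega), if_neg (by omega), zero_smul]
      filter_upwards [(h.memLp (i + 1)).coeFn_toLp,
        coeFn_sum_smul Finset.univ (fun j => M i j) (fun j : Fin n => g j)] with ω h2 h3
      rw [← h2, ← h3, ← h1]
    filter_upwards [eventually_all.2 hi] with ω hω
    funext i
    exact hω i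
  obtain ⟨h1, h2⟩ := entropy_of_map_eq_pi_gaussianReal (w := fun i : Fin n => (‖g i‖ ^ 2).toNNReal)
    hdet (by fun_prop) hYZ (fun i => (Real.toNNReal_pos.2 (hpos i)).ne')
    (map_eq_pi_gaussianReal (iIndepFun_toLp h.indep h.law) (hasLaw_toLp h.law)
      (fun i : Fin n => hgcl i)
      (fun i j hij => gramSchmidt_orthogonal ℝ f (fun hc => hij (Fin.ext hc)))
      (fun i => (Real.coe_toNNReal _ (hpos i).le).symm))
    (fun i => (Lp.memLp (g i)).integrable_sq)
    (fun i => by rw [← L2_norm_sq_eq_integral, Real.coe_toNNReal _ (hpos i).le])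
  refine ⟨h1, h2.trans ?_⟩
  simp_rw [Real.coe_toNNReal _ (hpos _).le]
  exact Fin.sum_univ_eq_sum_range
    (fun i => 1 / 2 * Real.log (2 * Real.pi * Real.exp 1 * ‖g i‖ ^ 2)) n

lemma IsARFIMA.hasEntropyRate (h : IsARFIMA P X ε d v) (hv : 0 < v) :
    HasEntropyRate P X (1 / 2 * Real.log (2 * Real.pi * Real.exp 1 * v)) := by
  have hv' : (0 : ℝ) < v := by exact_mod_cast hv
  refine ⟨fun n => (h.entropy hv n).1, ?_⟩
  have hlim := (h.isMovingAverage hv).tendsto_norm_gramSchmidt_sq hv' h.neg_half_lt h.lt_half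
    (inner_toLp_eq h.indep h.law)
  have hlog := (((hlim.const_mul (2 * Real.pi * Real.exp 1)).log (by positivity)).const_mul
    (1 / 2)).cesaro
  refine hlog.congr fun n => ?_
  rw [(h.entropy hv n).2]
  exact inv_mul_eq_div _ _

/-! ### Existence -/

lemma isARFIMA_of_isMovingAverage {x : ℤ → Lp ℝ 2 P} (hd : -(1 / 2) < d) (hd' : d < 1 / 2)
    (hv : 0 < v) (hind : iIndepFun ε P) (hlaw : ∀ n, HasLaw (ε n) (gaussianReal 0 v) P)
    (hx : IsMovingAverage (fun n => (memLp_of_hasLaw_gaussianReal (hlaw n)).toLp) x d) :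
    IsARFIMA P (fun n => x n) ε d v where
  neg_half_lt := hd
  lt_half := hd'
  indep := hind
  law := hlaw
  memLp n := Lp.memLp _
  stationary k := by
    refine ⟨by fun_prop, by fun_prop, ?_⟩
    have : IsProbabilityMeasure (P.map fun ω n => x n ω) :=
      Measure.isProbabilityMeasure_map (by fun_prop)
    -- The law on `ℤ → ℝ` is determined by its finite-dimensional marginals, which agree because
    -- shifting preserves norms of linear combinations.
    refine IsProjectiveLimit.unique
      (P := fun I : Finset ℤ => (P.map fun ω n => x n ω).map I.restrict) (fun I => ?_) fun I => rfl
    beta_reduce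
    rw [AEMeasurable.map_map_of_aemeasurable (by fun_prop) (by fun_prop),
      AEMeasurable.map_map_of_aemeasurable (by fun_prop) (by fun_prop)]
    refine map_eq_map_of_norm_eq (κ := I) (y := fun i => x (i + k)) (z := fun i => x i)
      (iIndepFun_toLp hind hlaw) (hasLaw_toLp hlaw)
      (fun i => hx.mem_closure _) (fun i => hx.mem_closure _) fun a => ?_
    exact hx.norm_sum_add (inner_toLp_eq hind hlaw) Finset.univ a (fun i => (i : ℤ)) k
  equation n := by
    have h := hx.tendsto (v := v) (by exact_mod_cast hv) hd hd' (inner_toLp_eq hind hlaw) n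
    rw [tendsto_iff_edist_tendsto_0] at h
    refine h.congr fun N => ?_
    rw [edist_eq_enorm_sub]
    have := eLpNorm_sum_sub (Finset.range N) (fracDiffCoeff d) (fun k => Lp.memLp (x (n - k)))
      (memLp_of_hasLaw_gaussianReal (hlaw n))
    simp_rw [Lp.toLp_coeFn] at this
    exact this.symm
  causal n δ hδ := by
    have h := (hx n).tendsto_sum_nat
    rw [tendsto_iff_edist_tendsto_0] at h
    obtain ⟨N, hN⟩ := (h.eventually (gt_mem_nhds hδ)).exists
    refine ⟨N, fracDiffCoeff (-d), ?_⟩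
    have := eLpNorm_sum_sub (Finset.range N) (fracDiffCoeff (-d))
      (fun k => memLp_of_hasLaw_gaussianReal (hlaw (n - k))) (Lp.memLp (x n))
    rw [edist_eq_enorm_sub] at hN
    rw [Lp.toLp_coeFn] at this
    rw [← this, ← eLpNorm_neg] at hN
    convert hN using 2
    ext ω
    simp

end LinearProcess

lemma exists_isARFIMA {d σ2 : ℝ} (hd : -(1 / 2) < d) (hd' : d < 1 / 2) (hσ : 0 < σ2) :
    ∃ (Ω : Type u) (_ : MeasurableSpace Ω) (P : Measure Ω) (_ : IsProbabilityMeasure P)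
      (X ε : ℤ → Ω → ℝ) (v : ℝ≥0), IsARFIMA P X ε d v ∧ Var[X 0; P] = σ2 := by
  have hW : 0 < Real.Gamma (1 - 2 * d) / Real.Gamma (1 - d) ^ 2 :=
    div_pos (Real.Gamma_pos_of_pos (by linarith))
      (pow_pos (Real.Gamma_pos_of_pos (by linarith)) 2)
  obtain ⟨v, hv, hvW⟩ : ∃ v : ℝ≥0, 0 < v ∧
      v * (Real.Gamma (1 - 2 * d) / Real.Gamma (1 - d) ^ 2) = σ2 := by
    refine ⟨(σ2 / (Real.Gamma (1 - 2 * d) / Real.Gamma (1 - d) ^ 2)).toNNReal,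
      Real.toNNReal_pos.2 (div_pos hσ hW), ?_⟩
    rw [Real.coe_toNNReal _ (div_pos hσ hW).le, div_mul_cancel₀ _ hW.ne']
  -- The canonical product space; the index is lifted only to place it in universe `u`.
  let P : Measure (ULift.{u} ℤ → ℝ) := Measure.infinitePi fun _ => gaussianReal 0 v
  let ε : ℤ → (ULift.{u} ℤ → ℝ) → ℝ := fun n ω => ω ⟨n⟩
  have hlaw : ∀ n, HasLaw (ε n) (gaussianReal 0 v) P := fun n =>
    ⟨by fun_prop, Measure.infinitePi_map_eval _ _⟩
  have hind : iIndepFun ε P :=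
    (iIndepFun_infinitePi (P := fun _ : ULift.{u} ℤ => gaussianReal 0 v) (X := fun _ x => x)
      fun _ => measurable_id).precomp ULift.up_injective
  have h := isARFIMA_of_isMovingAverage hd hd' hv hind hlaw
    (exists_isMovingAverage (v := v) (by exact_mod_cast hv) hd' (inner_toLp_eq hind hlaw))
  exact ⟨_, _, P, inferInstance, _, ε, v, h, (h.variance_eq hv).trans hvW⟩

/-! ### The approximate entropy rate of fractional Gaussian noise -/

lemma continuousAt_Gamma_comp {f : ℝ → ℝ} {x : ℝ} (hf : ContinuousAt f x) (hx : 0 < f x) :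
    ContinuousAt (fun y => Real.Gamma (f y)) x :=
  ContinuousAt.comp (g := Real.Gamma)
    (Real.differentiableAt_Gamma fun m => (lt_of_le_of_lt (by simp) hx).ne').continuousAt hf

lemma fgnApproxEntropyRate_eq {σ2 H : ℝ} (hσ : 0 < σ2) (h0 : 0 < H) (h1 : H < 1) :
    fgnApproxEntropyRate σ2 H = 1 / 2 * Real.log (2 * Real.pi * Real.exp 1) +
      (1 / 2 * Real.log (σ2 * Real.sin (Real.pi * H) * Real.Gamma (2 * H + 1)) +
        (1 - 2 * H) / 2 * (Real.log Real.pi - 1)) := by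
  have hpi := Real.pi_pos
  have hsin : 0 < Real.sin (Real.pi * H) :=
    Real.sin_pos_of_pos_of_lt_pi (by positivity) (by nlinarith)
  have hG : 0 < Real.Gamma (2 * H + 1) := Real.Gamma_pos_of_pos (by linarith)
  have hint : ∫ t in (-Real.pi)..Real.pi,
      Real.log (2 * Real.pi * fgnApproxSpectralDensity σ2 H t)
        = ∫ t in (-Real.pi)..Real.pi,
          (Real.log (σ2 * Real.sin (Real.pi * H) * Real.Gamma (2 * H + 1))
            + (1 - 2 * H) * Real.log t) := by
    -- Off `t = 0` the logarithm splits. `Real.log` ignores signs, so `log t` stands for `log |t|`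
    -- and `integral_log` applies across 0.
    refine intervalIntegral.integral_congr_ae ?_
    filter_upwards [(measure_eq_zero_iff_ae_notMem (μ := volume)).1
      (Real.volume_singleton (a := 0))] with t ht _
    have ht0 : 0 < |t| := abs_pos.2 ht
    rw [fgnApproxSpectralDensity, show 2 * Real.pi * (σ2 / (2 * Real.pi) * Real.sin (Real.pi * H) *
      Real.Gamma (2 * H + 1) * |t| ^ (1 - 2 * H)) = σ2 * Real.sin (Real.pi * H) *
      Real.Gamma (2 * H + 1) * |t| ^ (1 - 2 * H) by field_simp,
      Real.log_mul (by positivity) (Real.rpow_pos_of_pos ht0 _).ne', Real.log_rpow ht0,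
      Real.log_abs]
  rw [fgnApproxEntropyRate, hint, intervalIntegral.integral_add (by simp)
    (intervalIntegral.intervalIntegrable_log'.const_mul _), intervalIntegral.integral_const,
    intervalIntegral.integral_const_mul, integral_log, Real.log_neg_eq_log]
  simp only [smul_eq_mul]
  field_simp
  ring

lemma tendsto_fgnApproxEntropyRate {σ2 : ℝ} (hσ : 0 < σ2) :
    Tendsto (fun H => fgnApproxEntropyRate σ2 H) (𝓝[>] 0) atBot := by
  have hc : Tendsto (fun H : ℝ => σ2 * Real.sin (Real.pi * H) * Real.Gamma (2 * H + 1))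
      (𝓝 0) (𝓝 0) := by
    have hG : Tendsto (fun H : ℝ => Real.Gamma (2 * H + 1)) (𝓝 0) (𝓝 1) := by
      have h1 : ContinuousAt (fun H : ℝ => Real.Gamma (2 * H + 1)) 0 :=
        continuousAt_Gamma_comp (by fun_prop) (by norm_num)
      simpa using h1.tendsto
    have hs : Tendsto (fun H : ℝ => σ2 * Real.sin (Real.pi * H)) (𝓝 0) (𝓝 0) :=
      (by fun_prop : Continuous fun H : ℝ => σ2 * Real.sin (Real.pi * H)).tendsto' _ _ (by simp)
    simpa using hs.mul hG
  have hmem : Ioo (0 : ℝ) 1 ∈ 𝓝[>] (0 : ℝ) := Ioo_mem_nhdsGT one_pos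
  have hlog : Tendsto (fun H : ℝ => Real.log (σ2 * Real.sin (Real.pi * H) *
      Real.Gamma (2 * H + 1))) (𝓝[>] 0) atBot := by
    refine Real.tendsto_log_nhdsGT_zero.comp (tendsto_nhdsWithin_iff.2
      ⟨hc.mono_left nhdsWithin_le_nhds, ?_⟩)
    filter_upwards [hmem] with H hH
    exact mul_pos (mul_pos hσ (Real.sin_pos_of_pos_of_lt_pi (mul_pos Real.pi_pos hH.1)
      (by nlinarith [Real.pi_pos, hH.2]))) (Real.Gamma_pos_of_pos (by linarith [hH.1]))
  have hrest : Tendsto (fun H : ℝ => (1 - 2 * H) / 2 * (Real.log Real.pi - 1)) (𝓝[>] 0)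
      (𝓝 ((1 - 2 * 0) / 2 * (Real.log Real.pi - 1))) :=
    ((by fun_prop : Continuous fun H : ℝ => (1 - 2 * H) / 2 * (Real.log Real.pi - 1)).tendsto
      0).mono_left nhdsWithin_le_nhds
  refine (tendsto_atBot_add_const_left _ (1 / 2 * Real.log (2 * Real.pi * Real.exp 1))
    ((hlog.const_mul_atBot (by norm_num : (0 : ℝ) < 1 / 2)).atBot_add hrest)).congr' ?_
  filter_upwards [hmem] with H hH
  exact (fgnApproxEntropyRate_eq hσ hH.1 hH.2).symm

/-! ### The entropy rate of ARFIMA noise in terms of the variance -/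

/-- The entropy rate of an ARFIMA(0, `H - 1 / 2`, 0) process of variance `σ2`. -/
noncomputable def arfimaEntropyRate (σ2 H : ℝ) : ℝ :=
  1 / 2 * Real.log (2 * Real.pi * Real.exp 1 *
    (σ2 * (Real.Gamma (3 / 2 - H) ^ 2 / Real.Gamma (2 - 2 * H))))

lemma tendsto_arfimaEntropyRate_one {σ2 : ℝ} (hσ : 0 < σ2) :
    Tendsto (arfimaEntropyRate σ2) (𝓝[<] 1) atBot := by
  have hmem : Ioo (0 : ℝ) 1 ∈ 𝓝[<] (1 : ℝ) := Ioo_mem_nhdsLT one_pos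
  -- The pole is removed by writing `1 / Γ(s) = s / Γ(s + 1)` with `s = 2 - 2H`, an expression
  -- continuous at `H = 1` with value 0 there.
  have hc : Tendsto (fun H : ℝ => 2 * Real.pi * Real.exp 1 *
      (σ2 * (Real.Gamma (3 / 2 - H) ^ 2 * ((2 - 2 * H) / Real.Gamma (2 - 2 * H + 1))))) (𝓝 1)
      (𝓝 0) := by
    have h1 : ContinuousAt (fun H : ℝ => Real.Gamma (3 / 2 - H)) 1 :=
      continuousAt_Gamma_comp (by fun_prop) (by norm_num)
    have h2 : ContinuousAt (fun H : ℝ => Real.Gamma (2 - 2 * H + 1)) 1 :=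
      continuousAt_Gamma_comp (by fun_prop) (by norm_num)
    have h3 : ContinuousAt (fun H : ℝ => 2 - 2 * H) 1 := by fun_prop
    have : ContinuousAt (fun H : ℝ => 2 * Real.pi * Real.exp 1 * (σ2 * (Real.Gamma (3 / 2 - H) ^ 2 *
        ((2 - 2 * H) / Real.Gamma (2 - 2 * H + 1))))) 1 := (continuousAt_const (y := 2 * Real.pi * Real.exp 1)).mul
      ((continuousAt_const (y := σ2)).mul ((h1.pow 2).mul (h3.div h2 (by norm_num))))
    simpa using this.tendsto
  refine Tendsto.const_mul_atBot (by norm_num) (Real.tendsto_log_nhdsGT_zero.comp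
    (tendsto_nhdsWithin_iff.2 ⟨(hc.mono_left nhdsWithin_le_nhds).congr' ?_, ?_⟩))
  · filter_upwards [hmem] with H hH
    have h2 : 2 - 2 * H ≠ 0 := by linarith [hH.2]
    rw [Real.Gamma_add_one h2, div_mul_cancel_left₀ h2]
    exact congrArg _ (congrArg _ (div_eq_mul_inv _ _).symm)
  · filter_upwards [hmem] with H hH
    have h1 : 0 < Real.Gamma (3 / 2 - H) := Real.Gamma_pos_of_pos (by linarith [hH.2])
    have h2 : 0 < Real.Gamma (2 - 2 * H) := Real.Gamma_pos_of_pos (by linarith [hH.2])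
    rw [mem_Ioi]
    positivity

lemma tendsto_arfimaEntropyRate_zero {σ2 : ℝ} (hσ : 0 < σ2) :
    Tendsto (arfimaEntropyRate σ2) (𝓝[>] 0)
      (𝓝 (1 / 2 * Real.log (2 * Real.pi * Real.exp 1 * σ2) + Real.log (Real.Gamma (3 / 2)))) := by
  have hG : 0 < Real.Gamma (3 / 2) := Real.Gamma_pos_of_pos (by norm_num)
  have h1 : ContinuousAt (fun H : ℝ => Real.Gamma (3 / 2 - H)) 0 :=
      continuousAt_Gamma_comp (by fun_prop) (by norm_num)
  have h2 : ContinuousAt (fun H : ℝ => Real.Gamma (2 - 2 * H)) 0 :=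
      continuousAt_Gamma_comp (by fun_prop) (by norm_num)
  have h3 : ContinuousAt (fun H : ℝ => 2 * Real.pi * Real.exp 1 *
      (σ2 * (Real.Gamma (3 / 2 - H) ^ 2 / Real.Gamma (2 - 2 * H)))) 0 :=
    continuousAt_const.mul (continuousAt_const.mul ((h1.pow 2).div h2 (by simp)))
  have h : ContinuousAt (arfimaEntropyRate σ2) 0 :=
    continuousAt_const.mul (h3.log (by
      simp only [sub_zero, mul_zero, Real.Gamma_two]
      have := Real.pi_pos
      positivity))
  -- The closed form is continuous at `H = 0`, so the limit is its value there, with `Γ(2) = 1`.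
  have hval : 1 / 2 * Real.log (2 * Real.pi * Real.exp 1 * σ2) + Real.log (Real.Gamma (3 / 2))
      = arfimaEntropyRate σ2 0 := by
    have := Real.pi_pos
    rw [arfimaEntropyRate, mul_zero, sub_zero, sub_zero, Real.Gamma_two, div_one, ← mul_assoc,
      Real.log_mul (by positivity) (by positivity) (y := Real.Gamma (3 / 2) ^ 2),
      Real.log_pow]
    push_cast
    ring
  rw [hval]
  exact h.tendsto.mono_left nhdsWithin_le_nhds

theorem mainTheorem9 (σ2 : ℝ) (hσ : 0 < σ2) :
    ∃ h : ℝ → ℝ,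
      (∀ H ∈ Set.Ioo (0 : ℝ) 1,
        (∃ (Ω : Type u) (_ : MeasurableSpace Ω) (P : Measure Ω) (_ : IsProbabilityMeasure P)
            (X ε : ℤ → Ω → ℝ) (v : ℝ≥0),
          IsARFIMA P X ε (H - 1 / 2) v ∧ Var[X 0; P] = σ2) ∧
        (∀ (Ω : Type u) [MeasurableSpace Ω] (P : Measure Ω) [IsProbabilityMeasure P]
            (X ε : ℤ → Ω → ℝ) (v : ℝ≥0),
          IsARFIMA P X ε (H - 1 / 2) v → Var[X 0; P] = σ2 → HasEntropyRate P X (h H))) ∧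
      Tendsto h (𝓝[<] 1) atBot ∧
      Tendsto h (𝓝[>] 0)
        (𝓝 (1 / 2 * Real.log (2 * Real.pi * Real.exp 1 * σ2) + Real.log (Real.Gamma (3 / 2)))) ∧
      Tendsto (fun H => fgnApproxEntropyRate σ2 H) (𝓝[>] 0) atBot := by
  refine ⟨arfimaEntropyRate σ2, fun H hH => ⟨exists_isARFIMA (by linarith [hH.1])
    (by linarith [hH.2]) hσ, fun Ω _ P _ X ε v h hX => ?_⟩, tendsto_arfimaEntropyRate_one hσ,
    tendsto_arfimaEntropyRate_zero hσ, tendsto_fgnApproxEntropyRate hσ⟩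
  have hv : 0 < v := h.pos (by rw [hX]; exact hσ.ne')
  have hvar := h.variance_eq hv
  have h1 : 0 < Real.Gamma (3 / 2 - H) := Real.Gamma_pos_of_pos (by linarith [hH.2])
  have h2 : 0 < Real.Gamma (2 - 2 * H) := Real.Gamma_pos_of_pos (by linarith [hH.2])
  rw [hX, show 1 - 2 * (H - 1 / 2) = 2 - 2 * H by ring,
    show 1 - (H - 1 / 2) = 3 / 2 - H by ring] at hvar
  have hrate := h.hasEntropyRate hv
  -- The variance formula is solved for `v`, which shows that the rate depends only on `H` and `σ2`.
  rwa [show (v : ℝ) = σ2 * (Real.Gamma (3 / 2 - H) ^ 2 / Real.Gamma (2 - 2 * H)) by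
    rw [hvar, mul_assoc, div_mul_div_cancel₀ (by positivity), div_self h2.ne', mul_one]] at hrate
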